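/- All graphs are finite and simple. A drawing of a graph in the plane represents vertices by distinct points and edges by arcs (injective continuous curves) joining their end vertices, with no vertex point in the interior of an arc. Two edges cross if they have a common interior point; it is required of a drawing that two crossing edges have exactly one common interior point and no common end vertex. A drawing is $1$-planar if each edge is crossed by at most one other edge, and a graph is $1$-planar if it has a $1$-planar drawing. A graph $G$ is weakly locally maximal $1$-planar if it has a $1$-planar drawing such that, for any two crossing edges $uv$ and $xy$, the vertices $u,v,x,y$ induce in $G$ either a $K_4$ or a $K_4$ minus one edge, and none of the edges of $G$ joining $\{u,v\}$ to $\{x,y\}$ is crossed. A graph is $k$-connected if it has more than $k$ vertices and deleting fewer than $k$ vertices always leaves a connected graph. It is traceable if it has a path containing all its vertices. Let $\operatorname{circ}(G)$ be the number of vertices of a longest cycle of $G$, and for an infinite family $\mathcal G$ of graphs let $$\sigma(\mathcal G)=\liminf_{G\in\mathcal G,\ |V(G)|\to\infty}\frac{\log \operatorname{circ}(G)}{\log |V(G)|}$$ be its shortness exponent. Theorem. There are infinitely many pairwise non-isomorphic non-traceable $5$-connected weakly locally maximal $1$-planar graphs. Moreover, for the class $\Gamma$ of $5$-connected $1$-planar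 graphs, $$\sigma(\Gamma)\le\frac{\log 20}{\log 21}.$$ -/

import Mathlib

open Filter

/-- A drawing of `G` in the plane: vertices are distinct points, the edge `uv` is an arc
(an injective path) from the point of `u` to the point of `v`, and no arc has a vertex in its
interior. Two edges with a common interior point have no common end vertex, and they have only
one common interior point. The value of `arc` at a pair that is not an edge is irrelevant. -/
structure Drawing {V : Type*} (G : SimpleGraph V) where
  pos : V → ℝ × ℝ
  pos_injective : Function.Injective pos
  arc : Sym2 V → Set (ℝ × ℝ)
  arc_isArc : ∀ u v : V, G.Adj u v →
    ∃ γ : Path (pos u) (pos v), Function.Injective γ ∧ Set.range γ = arc s(u, v)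
  arc_vertex : ∀ e ∈ G.edgeSet, ∀ w : V, pos w ∈ arc e → w ∈ e
  cross_disjoint : ∀ e ∈ G.edgeSet, ∀ f ∈ G.edgeSet, e ≠ f →
    ((arc e ∩ arc f) \ Set.range pos).Nonempty → ∀ w : V, w ∈ e → w ∉ f
  cross_once : ∀ e ∈ G.edgeSet, ∀ f ∈ G.edgeSet, e ≠ f →
    ((arc e ∩ arc f) \ Set.range pos).Subsingleton

namespace Drawing

variable {V : Type*} {G : SimpleGraph V}

/-- Two distinct edges cross if they have an interior point in common. (The interior of an arc
consists of its points that are not vertex points.) -/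
def Crosses (D : Drawing G) (e f : Sym2 V) : Prop :=
  e ∈ G.edgeSet ∧ f ∈ G.edgeSet ∧ e ≠ f ∧
    ((D.arc e ∩ D.arc f) \ Set.range D.pos).Nonempty

/-- Every edge is crossed by at most one other edge (and then only once, by `cross_once`). -/
def IsOnePlanar (D : Drawing G) : Prop :=
  ∀ e f g : Sym2 V, D.Crosses e f → D.Crosses e g → f = g

/-- If two edges cross, then an edge joining an end vertex of one of them to an end vertex of the
other is not crossed. -/
def SidesUncrossed (D : Drawing G) : Prop :=
  ∀ e f : Sym2 V, D.Crosses e f → ∀ u ∈ e, ∀ x ∈ f, ∀ g : Sym2 V, ¬ D.Crosses s(u, x) g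

end Drawing

/-- The complete graph on four vertices with one edge removed. -/
def K4Minus : SimpleGraph (Fin 4) := (⊤ : SimpleGraph (Fin 4)).deleteEdges {s(0, 1)}

/-- The end vertices of `e` and `f` induce a `K₄`. -/
def FullPair {V : Type*} (G : SimpleGraph V) (e f : Sym2 V) : Prop :=
  Nonempty (G.induce {w | w ∈ e ∨ w ∈ f} ≃g (⊤ : SimpleGraph (Fin 4)))

/-- The end vertices of `e` and `f` induce a `K₄` minus one edge. -/
def AlmostFullPair {V : Type*} (G : SimpleGraph V) (e f : Sym2 V) : Prop :=
  Nonempty (G.induce {w | w ∈ e ∨ w ∈ f} ≃g K4Minus)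

/-- `G` has a 1-planar drawing. -/
def OnePlanar {V : Type*} (G : SimpleGraph V) : Prop :=
  ∃ D : Drawing G, D.IsOnePlanar

/-- `G` has a 1-planar drawing all of whose crossings are full or almost full. As usual for these
drawings, the sides of a crossing (if they are edges) are themselves required to be uncrossed. -/
def WeaklyLocallyMaximalOnePlanar {V : Type*} (G : SimpleGraph V) : Prop :=
  ∃ D : Drawing G, D.IsOnePlanar ∧ D.SidesUncrossed ∧
    ∀ e f : Sym2 V, D.Crosses e f → FullPair G e f ∨ AlmostFullPair G e f

/-- `k`-connectedness of a finite graph: there are more than `k` vertices, and deleting fewer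
than `k` vertices leaves a connected graph. -/
def KConnected {V : Type*} [Fintype V] (k : ℕ) (G : SimpleGraph V) : Prop :=
  k < Fintype.card V ∧ ∀ S : Finset V, S.card < k → (G.induce {v | v ∉ S}).Connected

/-- `G` has a path through all vertices. -/
def Traceable {V : Type*} [DecidableEq V] (G : SimpleGraph V) : Prop :=
  ∃ (a b : V) (p : G.Walk a b), p.IsHamiltonian

/-- The number of vertices (equivalently, of edges) of a longest cycle of a finite graph
(`0` if there is no cycle). -/
noncomputable def circ {V : Type*} (G : SimpleGraph V) : ℕ :=
  sSup {n : ℕ | ∃ (v : V) (p : G.Walk v v), p.IsCycle ∧ p.length = n}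

/-- Finite simple graphs; every finite graph is isomorphic to one of these. -/
abbrev FinGraph : Type := Σ n : ℕ, SimpleGraph (Fin n)

/-- The shortness exponent of a family of graphs: the lower limit of
`log (circ G) / log |V(G)|` over the members `G` of the family as `|V(G)| → ∞`. The value is taken
in the extended reals, so a family without arbitrarily large members gets the value `⊤`. -/
noncomputable def shortnessExponent (𝒢 : Set FinGraph) : EReal :=
  liminf (fun G : FinGraph => ((Real.log (circ G.2) / Real.log G.1 : ℝ) : EReal))
    (comap (fun G : FinGraph => G.1) atTop ⊓ 𝓟 𝒢)

/-! The construction iterates a toughness argument. The base graph has 25 skeleton vertices on four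
nested cycles and 27 pairwise non-adjacent sites, each joined to five skeleton vertices by edges
called links here. A site may be replaced by a whole graph with five roots, each root taking over
one link (`Frame.plug`). The result has the outermost cycle as its roots, so the replacement can be
repeated (`Nest.tower`).

Long cycles and paths: a gadget at a site can be left only towards a skeleton vertex, and a cycle or
path enters each skeleton vertex at most once. Hence a cycle meets at most 25 of the 27 sites. If
all sites are replaced at each step, the bound on cycle lengths grows by the factor 25 up to an
additive constant, while the order grows by at least 27 (`Frame.cycleBound_plug`). The exponent is
therefore at most log 25 / log 27, which is smaller than log 20 / log 21. A Hamiltonian path would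
have to leave every site but the one where it ends, at least 26 exits into 25 vertices
(`Frame.not_traceable_plug`).

Connectivity: a deleted set of four vertices projects to at most four vertices of the base graph,
which stays connected because of explicit systems of five disjoint paths (`Nest.unsplittable_core`).
A vertex in a damaged gadget escapes through one of the five links, since a deleted vertex destroys
at most one of them as long as the gadget has a survivor (`Frame.robust_plug`).

Drawing: all edges are straight. The skeleton lies in a pentagon, and a copy of the pentagon scaled
by 1/100 sits in a small box at every site. The only new crossings are between designated pairs of
links at different sites (`Frame.Layout.crosses_plug`), so 1-planarity is inherited. When both sites
of such a pair hold single vertices, the four ends induce a `K₄` without the edge between these two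
vertices. No link at the innermost site is crossed, so replacing only that site keeps every crossing
almost full and yields infinitely many examples for the first assertion. -/

/-- A finite graph with five (not necessarily distinct) roots and a position for each vertex. -/
structure Gadget where
  V : Type
  [fintypeV : Fintype V]
  [decEqV : DecidableEq V]
  graph : SimpleGraph V
  root : Fin 5 → V
  pos : V → ℝ × ℝ

attribute [instance] Gadget.fintypeV Gadget.decEqV

/-- A graph on `S` with five roots, together with a family `T` of sites, each of which is to be
joined to five vertices of `S`. The map `place t` puts a copy of the plane at the site `t`. -/
structure Frame (S T : Type) where
  graph : SimpleGraph S
  nb : T → Fin 5 → S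
  nb_injective : ∀ t, Function.Injective (nb t)
  root : Fin 5 → S
  root_injective : Function.Injective root
  pos : S → ℝ × ℝ
  place : T → (ℝ × ℝ) →ᵃ[ℝ] (ℝ × ℝ)

/-! ### Connectedness after deleting vertices -/

/-- The vertices of `V` outside of `F` that can be reached from `u` without entering `F`. -/
def AvoidReach {V : Type*} (G : SimpleGraph V) (F : Finset V) : V → V → Prop :=
  Relation.ReflTransGen fun a b => G.Adj a b ∧ b ∉ F

namespace AvoidReach

variable {V : Type*} {G : SimpleGraph V} {F : Finset V}

/-- Only entered vertices are tested against `F`, so the start must be known to lie outside of `F`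
before a walk can be reversed. -/
theorem symm {u v : V} (hu : u ∉ F) (h : AvoidReach G F u v) : AvoidReach G F v u := by
  have key : v ∉ F ∧ AvoidReach G F v u := by
    induction h with
    | refl => exact ⟨hu, .refl⟩
    | tail _ hbc ih => exact ⟨hbc.2, (Relation.ReflTransGen.single ⟨hbc.1.symm, ih.1⟩).trans ih.2⟩
  exact key.2

theorem reachable {u v : V} (hu : u ∉ F) (h : AvoidReach G F u v) :
    ∃ hv : v ∉ F, (G.induce {v | v ∉ F}).Reachable ⟨u, hu⟩ ⟨v, hv⟩ := by
  induction h with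
  | refl => exact ⟨hu, .refl _⟩
  | tail _ hbc ih =>
    obtain ⟨hv, hr⟩ := ih
    refine ⟨hbc.2, hr.trans (SimpleGraph.Adj.reachable ?_)⟩
    exact hbc.1

theorem image {W : Type*} {G' : SimpleGraph W} {F' : Finset W} (f : V → W)
    (hadj : ∀ a b, G.Adj a b → G'.Adj (f a) (f b)) (hF : ∀ a, a ∉ F → f a ∉ F') {u v : V}
    (h : AvoidReach G F u v) : AvoidReach G' F' (f u) (f v) :=
  by
  induction h with
  | refl => exact .refl
  | tail _ hbc ih => exact ih.tail ⟨hadj _ _ hbc.1, hF _ hbc.2⟩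

end AvoidReach

/-- Deleting at most four vertices does not disconnect the graph. -/
def Unsplittable {V : Type*} (G : SimpleGraph V) : Prop :=
  ∀ F : Finset V, F.card ≤ 4 → ∀ u v, u ∉ F → v ∉ F → AvoidReach G F u v

theorem Unsplittable.kConnected {V : Type*} [Fintype V] {G : SimpleGraph V}
    (h : Unsplittable G) (hcard : 5 < Fintype.card V) : KConnected 5 G := by
  classical
  refine ⟨hcard, fun F hF => ?_⟩
  have hne : ∃ v, v ∉ F := by
    by_contra! hall
    have : F = Finset.univ := Finset.eq_univ_iff_forall.2 hall
    rw [this, Finset.card_univ] at hF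
    omega
  obtain ⟨v, hv⟩ := hne
  have : Nonempty {v | v ∉ F} := ⟨⟨v, hv⟩⟩
  refine SimpleGraph.Connected.mk fun a b => ?_
  obtain ⟨_, hr⟩ := (h F (by omega) a b a.2 b.2).reachable a.2
  exact hr

theorem Unsplittable.comap {V W : Type*} {G : SimpleGraph V} (h : Unsplittable G)
    (e : W ≃ V) : Unsplittable (G.comap e) := by
  intro F hF u v hu hv
  have := (h (F.map e.toEmbedding) (by simpa using hF) (e u) (e v) (by simpa using hu)
    (by simpa using hv)).image (G' := G.comap e) (F' := F) e.symm (by simp) (fun a ha hb => ha ?_)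
  · simpa using this
  · simpa [Finset.mem_map_equiv] using hb

namespace Gadget

/-- Deleting at most four vertices does not disconnect the gadget, and it deletes as many roots
as vertices at most, if it leaves a vertex. -/
def Robust (H : Gadget) : Prop :=
  Unsplittable H.graph ∧ ∀ F : Finset H.V, (∃ v, v ∉ F) →
    (Finset.univ.filter fun i => H.root i ∈ F).card ≤ F.card

/-- The gadget with one vertex, placed at `o`. -/
def point (o : ℝ × ℝ) : Gadget where
  V := Unit
  graph := ⊥
  root _ := ()
  pos _ := o

/-- All five roots coincide, so deleting one vertex would delete five roots; but then nothing is
left, and the condition asks nothing. -/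
theorem robust_point (o : ℝ × ℝ) : (point o).Robust := by
  refine ⟨fun F _ u v _ _ => .refl, ?_⟩
  rintro F ⟨v, hv⟩
  rw [Finset.card_eq_zero.2]
  · exact Nat.zero_le _
  · exact Finset.filter_eq_empty_iff.2 fun i _ hi => hv hi

end Gadget

/-! ### Inserting gadgets into a frame, and 5-connectedness -/

namespace Frame

variable {S T : Type} (B : Frame S T)

/-- Adjacency in the graph obtained from the frame by inserting gadgets at the sites. -/
inductive PlugAdj (H : T → Gadget) : S ⊕ (Σ t, (H t).V) → S ⊕ (Σ t, (H t).V) → Prop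
  | skeleton {a b : S} (h : B.graph.Adj a b) : PlugAdj H (.inl a) (.inl b)
  | link (t : T) (i : Fin 5) : PlugAdj H (.inl (B.nb t i)) (.inr ⟨t, (H t).root i⟩)
  | link_symm (t : T) (i : Fin 5) : PlugAdj H (.inr ⟨t, (H t).root i⟩) (.inl (B.nb t i))
  | inner (t : T) {u v : (H t).V} (h : (H t).graph.Adj u v) :
      PlugAdj H (.inr ⟨t, u⟩) (.inr ⟨t, v⟩)

variable [Fintype S] [DecidableEq S] [Fintype T] [DecidableEq T]

/-- The gadget obtained from the frame by inserting gadgets at the sites. -/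
@[reducible] def plug (H : T → Gadget) : Gadget where
  V := S ⊕ (Σ t, (H t).V)
  graph :=
    { Adj := B.PlugAdj H
      symm := ⟨by
        rintro _ _ (h | ⟨t, i⟩ | ⟨t, i⟩ | ⟨t, h⟩)
        · exact .skeleton h.symm
        · exact .link_symm t i
        · exact .link t i
        · exact .inner t h.symm⟩
      loopless := ⟨by
        have key : ∀ x y, B.PlugAdj H x y → x ≠ y := by
          rintro _ _ (h | ⟨t, i⟩ | ⟨t, i⟩ | ⟨t, h⟩)
          · simpa using h.ne
          · simp
          · simp
          · simpa using h.ne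
        exact fun x h => key x x h rfl⟩ }
  root i := .inl (B.root i)
  pos := Sum.elim B.pos fun x => B.place x.1 ((H x.1).pos x.2)

/-- The frame with each site regarded as a vertex. -/
def core : SimpleGraph (S ⊕ T) where
  Adj
    | .inl a, .inl b => B.graph.Adj a b
    | .inl a, .inr t => ∃ i, B.nb t i = a
    | .inr t, .inl a => ∃ i, B.nb t i = a
    | .inr _, .inr _ => False
  symm := ⟨by
    rintro (a | t) (b | t') h
    · exact SimpleGraph.Adj.symm (G := B.graph) h
    · exact h
    · exact h
    · exact h⟩
  loopless := ⟨by
    rintro (a | t) h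
    · exact B.graph.irrefl h
    · exact h⟩

variable {B} {H : T → Gadget}

/-- The vertex of the core to which a vertex of the plugged frame belongs. -/
def proj (H : T → Gadget) : (B.plug H).V → S ⊕ T := Sum.map id Sigma.fst

/-- A path in the core outside the projection of `F` lifts: each site on it holds an undamaged,
hence connected, gadget, and each core edge comes from an edge between the corresponding parts. -/
theorem avoidReach_of_core (hH : ∀ t, (H t).Robust) (F : Finset (B.plug H).V) {x y : S ⊕ T}
    (hx : x ∉ F.image (proj H))
    (h : AvoidReach B.core (F.image (proj H)) x y) (u v : (B.plug H).V) (hu : proj H u = x)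
    (hv : proj H v = y) : AvoidReach (B.plug H).graph F u v := by
  have hout : ∀ w : (B.plug H).V, proj H w ∉ F.image (proj H) → w ∉ F := fun w hw hwF =>
    hw (Finset.mem_image_of_mem _ hwF)
  have hsame : ∀ w w' : (B.plug H).V, proj H w ∉ F.image (proj H) → proj H w = proj H w' →
      AvoidReach (B.plug H).graph F w w' := by
    rintro (a | ⟨t, a⟩) (b | ⟨t', b⟩) hw hww
    · obtain rfl : a = b := by simpa [proj] using hww
      exact .refl
    · simp [proj] at hww
    · simp [proj] at hww
    · obtain rfl : t = t' := by simpa [proj] using hww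
      -- Nothing is deleted at this site, so connectedness of the gadget is used with the empty set.
      refine ((hH t).1 ∅ (by simp) a b (by simp) (by simp)).image
        (G' := (B.plug H).graph) (fun c => .inr ⟨t, c⟩)
        (fun _ _ hc => PlugAdj.inner t hc) fun c _ => hout _ ?_
      exact hw
  induction h generalizing v with
  | refl => exact hsame u v (hu ▸ hx) (hu.trans hv.symm)
  | @tail y z hxy hyz ih =>
    obtain ⟨w, w', hw, hw', hadj⟩ : ∃ w w' : (B.plug H).V, proj H w = y ∧ proj H w' = z ∧
        (B.plug H).graph.Adj w w' := by
      obtain ⟨hyz, -⟩ := hyz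
      rcases y with a | t <;> rcases z with b | t'
      · exact ⟨.inl a, .inl b, rfl, rfl, .skeleton hyz⟩
      · obtain ⟨i, rfl⟩ := hyz
        exact ⟨_, _, rfl, rfl, .link t' i⟩
      · obtain ⟨i, rfl⟩ := hyz
        exact ⟨_, _, rfl, rfl, .link_symm t i⟩
      · exact hyz.elim
    have hw'F : proj H w' ∉ F.image (proj H) := hw' ▸ hyz.2
    exact ((ih w hw).tail ⟨hadj, hout _ hw'F⟩).trans (hsame w' v hw'F (hw'.trans hv.symm))

/-- The five links end in distinct skeleton vertices, and deletions in a gadget that keeps a vertex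
remove at most as many roots as vertices. So four deletions destroy at most four of the five links.
-/
theorem exists_surviving_link (hH : ∀ t, (H t).Robust) (F : Finset (B.plug H).V)
    (hF : F.card ≤ 4) (t : T) (hsurv : ∃ v : (H t).V, (.inr ⟨t, v⟩ : (B.plug H).V) ∉ F) :
    ∃ i, (.inl (B.nb t i) : (B.plug H).V) ∉ F ∧
      (.inr ⟨t, (H t).root i⟩ : (B.plug H).V) ∉ F := by
  classical
  let FS : Finset S := Finset.univ.filter fun a => (.inl a : (B.plug H).V) ∈ F
  let Ft : Finset (H t).V := Finset.univ.filter fun a => (.inr ⟨t, a⟩ : (B.plug H).V) ∈ F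
  have hcard : FS.card + Ft.card ≤ F.card := by
    rw [← Finset.card_image_of_injective FS (f := fun a => (.inl a : (B.plug H).V))
        (fun a b hab => by simpa using hab),
      ← Finset.card_image_of_injective Ft (f := fun a => (.inr ⟨t, a⟩ : (B.plug H).V))
        (fun a b hab => by simpa using hab), ← Finset.card_union_of_disjoint]
    · refine Finset.card_le_card fun x hx => ?_
      simp only [Finset.mem_union, Finset.mem_image, FS, Ft, Finset.mem_filter] at hx
      rcases hx with ⟨a, ha, rfl⟩ | ⟨a, ha, rfl⟩
      · exact ha.2
      · exact ha.2
    · rw [Finset.disjoint_left]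
      simp
  have h1 : (Finset.univ.filter fun i => B.nb t i ∈ FS).card ≤ FS.card := by
    rw [← Finset.card_image_of_injective _ (B.nb_injective t)]
    refine Finset.card_le_card fun x hx => ?_
    simp only [Finset.mem_image, Finset.mem_filter] at hx
    obtain ⟨i, hi, rfl⟩ := hx
    exact hi.2
  have h2 : (Finset.univ.filter fun i => (H t).root i ∈ Ft).card ≤ Ft.card := by
    refine (hH t).2 Ft ?_
    obtain ⟨v, hv⟩ := hsurv
    exact ⟨v, by simpa [Ft] using hv⟩
  by_contra! hall
  have hcover : (Finset.univ : Finset (Fin 5)) ⊆ (Finset.univ.filter fun i => B.nb t i ∈ FS) ∪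
      (Finset.univ.filter fun i => (H t).root i ∈ Ft) := by
    intro i _
    by_cases hi : (.inl (B.nb t i) : (B.plug H).V) ∈ F
    · exact Finset.mem_union_left _ (by simpa [FS] using hi)
    · exact Finset.mem_union_right _ (by simpa [Ft] using hall i hi)
  have := (Finset.card_le_card hcover).trans (Finset.card_union_le _ _)
  simp only [Finset.card_univ, Fintype.card_fin] at this
  omega

/-- A surviving vertex of a damaged gadget walks inside the gadget to a surviving link and out to
the skeleton; from there the connectedness of the core takes over. The bound on roots is immediate
because the new roots are distinct. -/
theorem robust_plug (hB : Unsplittable B.core) (hH : ∀ t, (H t).Robust) :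
    (B.plug H).Robust := by
  classical
  refine ⟨fun F hF u v hu hv => ?_, fun F _ => ?_⟩
  · have hF' : (F.image (proj H)).card ≤ 4 := Finset.card_image_le.trans hF
    have hescape : ∀ w : (B.plug H).V, w ∉ F → ∃ w' : (B.plug H).V,
        proj H w' ∉ F.image (proj H) ∧ AvoidReach (B.plug H).graph F w w' := by
      intro w hw
      by_cases hwF : proj H w ∈ F.image (proj H)
      · rcases w with a | ⟨t, a⟩
        · exfalso
          rw [Finset.mem_image] at hwF
          obtain ⟨w', hw', hww⟩ := hwF
          rcases w' with b | ⟨t', b⟩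
          · obtain rfl : b = a := by simpa [proj] using hww
            exact hw hw'
          · simp [proj] at hww
        · obtain ⟨i, hi, hri⟩ := exists_surviving_link hH F hF t ⟨a, hw⟩
          refine ⟨.inl (B.nb t i), ?_, ?_⟩
          · rw [Finset.mem_image]
            rintro ⟨w', hw', hww⟩
            rcases w' with b | ⟨t', b⟩
            · obtain rfl : b = B.nb t i := by simpa [proj] using hww
              exact hi hw'
            · simp [proj] at hww
          · let Ft : Finset (H t).V :=
              Finset.univ.filter fun a => (.inr ⟨t, a⟩ : (B.plug H).V) ∈ F
            have hFt : Ft.card ≤ 4 := by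
              refine le_trans ?_ hF
              refine Finset.card_le_card_of_injOn (fun a => (.inr ⟨t, a⟩ : (B.plug H).V))
                (fun x hx => ?_) (fun x _ y _ hxy => by simpa using hxy)
              simpa [Ft] using hx
            have := ((hH t).1 Ft hFt a ((H t).root i) (by simpa [Ft] using hw)
              (by simpa [Ft] using hri)).image (G' := (B.plug H).graph) (F' := F)
              (fun c => .inr ⟨t, c⟩) (fun _ _ hc => PlugAdj.inner t hc)
              (fun c hc => by simpa [Ft] using hc)
            exact this.tail ⟨.link_symm t i, hi⟩
      · exact ⟨w, hwF, .refl⟩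
    obtain ⟨u', hu', huu⟩ := hescape u hu
    obtain ⟨v', hv', hvv⟩ := hescape v hv
    exact (huu.trans (avoidReach_of_core hH F hu' (hB _ hF' _ _ hu' hv') u' v' rfl rfl)).trans
      (hvv.symm hv)
  · refine Finset.card_le_card_of_injOn (B.plug H).root (fun i hi => by simpa using hi) ?_
    intro i _ j _ hij
    exact B.root_injective (by simpa [plug] using hij)

end Frame

/-! ### Counting exits: long cycles and Hamiltonian paths -/

namespace SimpleGraph.Walk

variable {V : Type*} {G : SimpleGraph V}

/-- No vertex is entered twice. The hypothesis concerns the tail of the support so as to cover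
cycles as well as paths. -/
theorem eq_of_mem_darts_of_snd_eq {u v : V} {p : G.Walk u v} (hp : p.support.tail.Nodup)
    {d d' : G.Dart} (hd : d ∈ p.darts) (hd' : d' ∈ p.darts) (h : d.snd = d'.snd) : d = d' := by
  rw [← map_snd_darts] at hp
  exact List.inj_on_of_nodup_map hp hd hd' h

/-- Rotating the closed walk to start in `D` makes the later visit to `y` force an exit. -/
theorem exists_exit_dart [DecidableEq V] {v : V} (p : G.Walk v v) (D : Set V) {x y : V}
    (hx : x ∈ p.support) (hxD : x ∈ D) (hy : y ∈ p.support) (hyD : y ∉ D) :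
    ∃ d ∈ p.darts, d.fst ∈ D ∧ d.snd ∉ D := by
  have hy' : y ∈ (p.rotate x hx).support := (mem_support_rotate_iff p x hx).2 hy
  obtain ⟨d, hd, h1, h2⟩ := ((p.rotate x hx).takeUntil y hy').exists_boundary_dart D hxD hyD
  exact ⟨d, (rotate_darts p x hx).mem_iff.1 (darts_takeUntil_subset_darts _ hy' hd), h1, h2⟩

end SimpleGraph.Walk

namespace Gadget

/-- Wherever the gadget sits in a larger graph, attached to the rest by its roots only, a cycle of
the larger graph meets it in at most `b` vertices. -/
def CycleBound (H : Gadget) (b : ℕ) : Prop :=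
  ∀ (W : Type) [DecidableEq W] (G : SimpleGraph W) (ι : H.V → W), Function.Injective ι →
    (∀ x y, G.Adj (ι x) (ι y) → H.graph.Adj x y) →
    (∀ x w, G.Adj (ι x) w → w ∉ Set.range ι → x ∈ Set.range H.root) →
    ∀ (w : W) (p : G.Walk w w), p.IsCycle →
      (Finset.univ.filter fun x => ι x ∈ p.support).card ≤ b

theorem cycleBound_point (o : ℝ × ℝ) : (point o).CycleBound 1 := by
  intro W _ G ι _ _ _ w p _
  exact Finset.card_le_one.2 fun _ _ _ _ => rfl

/-- The gadget itself serves as the larger graph. The tail of the support lists each vertex of the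
cycle once, which turns the bound on vertices into one on length. -/
theorem CycleBound.circ_le {H : Gadget} {b : ℕ} (h : H.CycleBound b) {W : Type}
    [DecidableEq W] (e : W ≃ H.V) : circ (H.graph.comap e) ≤ b := by
  refine csSup_le' ?_
  rintro n ⟨v, p, hp, rfl⟩
  have hb := h W (H.graph.comap e) e.symm e.symm.injective (fun x y hxy => by simpa using hxy)
    (fun x w _ hw => (hw (e.symm.surjective w)).elim) v p hp
  refine le_trans ?_ hb
  have hlen : p.support.tail.length = p.length := by simp
  rw [← hlen, ← List.toFinset_card_of_nodup hp.support_nodup]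
  refine Finset.card_le_card_of_injOn e (fun x hx => ?_) e.injective.injOn
  have : x ∈ p.support := List.mem_of_mem_tail (by simpa using hx)
  simpa using this

end Gadget

namespace Frame

variable {S T : Type} {B : Frame S T} [Fintype S] [DecidableEq S] [Fintype T] [DecidableEq T]
  {H : T → Gadget}

/-- An edge that leaves the gadget at a site of the plugged frame ends in the frame. -/
theorem exists_eq_inl_of_adj {t : T} {v : (H t).V} {x : (B.plug H).V}
    (h : (B.plug H).graph.Adj (.inr ⟨t, v⟩) x) :
    (∃ a, x = .inl a ∧ v ∈ Set.range (H t).root) ∨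
      ∃ u, x = .inr ⟨t, u⟩ ∧ (H t).graph.Adj v u := by
  generalize hy : (.inr ⟨t, v⟩ : (B.plug H).V) = y at h
  cases h with
  | skeleton h => simp at hy
  | link t i => simp at hy
  | link_symm t' i =>
    obtain ⟨rfl, hv⟩ : t = t' ∧ HEq v ((H t').root i) := by simpa using hy
    exact .inl ⟨_, rfl, i, (eq_of_heq hv).symm⟩
  | @inner t' u w h =>
    obtain ⟨rfl, hv⟩ : t = t' ∧ HEq v u := by simpa using hy
    obtain rfl := eq_of_heq hv
    exact .inr ⟨w, rfl, h⟩

/-- Choosing for each visited site an exit into the skeleton gives an injection from visited sites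
to skeleton vertices. Each visited site contributes at most `b` vertices, because its gadget is
again attached by its roots only; this is why `CycleBound` quantifies over all surrounding graphs.
-/
theorem cycleBound_plug {b : ℕ} (hH : ∀ t, (H t).CycleBound b) :
    (B.plug H).CycleBound (Fintype.card S + Fintype.card S * b) := by
  classical
  intro W _ G ι hι hadj hroot w p hp
  let R : Finset T := Finset.univ.filter fun t => ∃ v, ι (.inr ⟨t, v⟩) ∈ p.support
  have hS : 1 ≤ Fintype.card S := Fintype.card_pos_iff.2 ⟨B.root 0⟩
  have hR : R.card ≤ Fintype.card S := by
    -- A cycle that stays inside one gadget has no exit, so this case is treated apart.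
    by_cases hR1 : R.card ≤ 1
    · exact hR1.trans hS
    have hexit : ∀ t : R, ∃ (a : S) (v : (H t).V) (d : G.Dart), d ∈ p.darts ∧
        d.fst = ι (.inr ⟨t, v⟩) ∧ d.snd = ι (.inl a) := by
      rintro ⟨t, ht⟩
      obtain ⟨t', ht', hne⟩ := Finset.exists_mem_ne (by omega : 1 < R.card) t
      obtain ⟨v, hv⟩ := (Finset.mem_filter.1 ht).2
      obtain ⟨v', hv'⟩ := (Finset.mem_filter.1 ht').2
      obtain ⟨d, hd, ⟨u, hu⟩, h2⟩ := p.exists_exit_dart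
        (Set.range fun v : (H t).V => ι (.inr ⟨t, v⟩)) hv ⟨v, rfl⟩ hv' (by
          rintro ⟨u, hu⟩
          have := hι hu
          simp only [Sum.inr.injEq, Sigma.mk.injEq] at this
          exact hne this.1.symm)
      have hadj' : G.Adj (ι (.inr ⟨t, u⟩)) d.snd := by
        have := d.adj
        rwa [← hu] at this
      by_cases hds : d.snd ∈ Set.range ι
      · obtain ⟨x, hx⟩ := hds
        rw [← hx] at hadj'
        rcases exists_eq_inl_of_adj (hadj _ _ hadj') with ⟨a, rfl, -⟩ | ⟨u', rfl, -⟩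
        · exact ⟨a, u, d, hd, hu.symm, hx.symm⟩
        · exact (h2 ⟨u', hx⟩).elim
      · obtain ⟨i, hi⟩ := hroot _ _ hadj' hds
        simp at hi
    choose f g d hd h1 h2 using hexit
    rw [← Fintype.card_coe]
    refine Fintype.card_le_of_injective f fun t t' htt => ?_
    have hdd := SimpleGraph.Walk.eq_of_mem_darts_of_snd_eq hp.support_nodup (hd t) (hd t')
      (by rw [h2, h2, htt])
    have := h1 t
    rw [hdd, h1 t'] at this
    have := hι this
    simp only [Sum.inr.injEq, Sigma.mk.injEq] at this
    exact Subtype.ext this.1.symm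
  have hdisc : ∀ t, (Finset.univ.filter fun v : (H t).V => ι (.inr ⟨t, v⟩) ∈ p.support).card ≤
      b := by
    intro t
    refine hH t W G (fun v => ι (.inr ⟨t, v⟩)) (fun x y hxy => ?_) (fun x y hxy => ?_)
      (fun x y hxy hy => ?_) w p hp
    · simpa using hι hxy
    · rcases exists_eq_inl_of_adj (hadj _ _ hxy) with ⟨a, ha, -⟩ | ⟨u, hu, hxu⟩
      · simp at ha
      · obtain rfl : y = u := by simpa using hu
        exact hxu
    · by_cases hyι : y ∈ Set.range ι
      · obtain ⟨z, rfl⟩ := hyι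
        rcases exists_eq_inl_of_adj (hadj _ _ hxy) with ⟨a, rfl, hx⟩ | ⟨u, rfl, -⟩
        · exact hx
        · exact (hy ⟨u, rfl⟩).elim
      · obtain ⟨i, hi⟩ := hroot _ _ hxy hyι
        simp at hi
  have hsub : (Finset.univ.filter fun x : (B.plug H).V => ι x ∈ p.support) ⊆
      (Finset.univ.image fun a : S => (.inl a : (B.plug H).V)) ∪
        R.biUnion fun t => (Finset.univ.filter fun v : (H t).V =>
          ι (.inr ⟨t, v⟩) ∈ p.support).image fun v => (.inr ⟨t, v⟩ : (B.plug H).V) := by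
    intro x hx
    rw [Finset.mem_filter] at hx
    rcases x with a | ⟨t, v⟩
    · exact Finset.mem_union_left _ (by simp)
    · refine Finset.mem_union_right _ (Finset.mem_biUnion.2 ⟨t, ?_, ?_⟩)
      · exact Finset.mem_filter.2 ⟨Finset.mem_univ _, v, hx.2⟩
      · exact Finset.mem_image.2 ⟨v, Finset.mem_filter.2 ⟨Finset.mem_univ _, hx.2⟩, rfl⟩
  refine (Finset.card_le_card hsub).trans ((Finset.card_union_le _ _).trans ?_)
  refine Nat.add_le_add Finset.card_image_le ?_
  refine Finset.card_biUnion_le.trans ((Finset.sum_le_card_nsmul R _ b fun t _ =>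
    Finset.card_image_le.trans (hdisc t)).trans ?_)
  exact Nat.mul_le_mul_right _ hR

/-- Unlike a cycle, a path need not leave the site that contains its last vertex. This exception is
what costs the second unit in `hcard`. -/
theorem not_traceable_plug (hcard : Fintype.card S + 2 ≤ Fintype.card T)
    (hne : ∀ t, Nonempty (H t).V) {W : Type} [DecidableEq W] (e : W ≃ (B.plug H).V) :
    ¬ Traceable ((B.plug H).graph.comap e) := by
  classical
  rintro ⟨a, b, p, hp⟩
  have hexit : ∀ t : {t : T // (proj H (e b)) ≠ .inr t}, ∃ (s : S) (v : (H t).V)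
      (d : ((B.plug H).graph.comap e).Dart), d ∈ p.darts ∧
        e d.fst = (.inr ⟨t, v⟩) ∧ e d.snd = (.inl s) := by
    rintro ⟨t, ht⟩
    obtain ⟨v⟩ := hne t
    have hv : e.symm (.inr ⟨t, v⟩) ∈ p.support := hp.mem_support _
    obtain ⟨d, hd, ⟨u, hu⟩, h2⟩ := (p.dropUntil _ hv).exists_boundary_dart
      (Set.range fun v : (H t).V => e.symm (.inr ⟨t, v⟩)) ⟨v, rfl⟩ (by
        rintro ⟨u, hu⟩
        rw [e.symm_apply_eq] at hu
        exact ht (by rw [← hu]; rfl))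
    have hu' : e d.fst = .inr ⟨t, u⟩ := by rw [← hu]; simp
    have hadj : (B.plug H).graph.Adj (e d.fst) (e d.snd) := d.adj
    rw [hu'] at hadj
    rcases exists_eq_inl_of_adj hadj with ⟨s, hs, -⟩ | ⟨u', hs, -⟩
    · exact ⟨s, u, d, SimpleGraph.Walk.darts_dropUntil_subset_darts _ hv hd, hu', hs⟩
    · exact (h2 ⟨u', by simp [← hs]⟩).elim
  choose f g d hd h1 h2 using hexit
  have hinj : Function.Injective f := by
    intro t t' htt
    have hdd := SimpleGraph.Walk.eq_of_mem_darts_of_snd_eq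
      (hp.isPath.support_nodup.sublist (List.tail_sublist _)) (hd t) (hd t')
      (e.injective (by rw [h2, h2, htt]))
    have := h1 t
    rw [hdd, h1 t'] at this
    simp only [Sum.inr.injEq, Sigma.mk.injEq] at this
    exact Subtype.ext this.1.symm
  have h3 := Fintype.card_le_of_injective f hinj
  have h4 : Fintype.card T ≤ Fintype.card {t : T // (proj H (e b)) ≠ .inr t} + 1 := by
    rcases hb : proj H (e b) with s | t
    · simp
    · have : Fintype.card {t' : T // (Sum.inr t : S ⊕ T) ≠ .inr t'} = Fintype.card T - 1 := by
        rw [← Fintype.card_subtype_eq t, ← Fintype.card_subtype_compl]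
        exact Fintype.card_congr (Equiv.subtypeEquivRight fun x => by simp [eq_comm])
      omega
  omega

end Frame

/-! ### Straight-line drawings of gadgets -/

namespace Gadget

/-- The straight-line segment that represents an edge. -/
def arc (H : Gadget) : Sym2 H.V → Set (ℝ × ℝ) :=
  Sym2.lift ⟨fun u v => segment ℝ (H.pos u) (H.pos v), fun _ _ => segment_symm ℝ _ _⟩

/-- Two edges cross in the straight-line drawing. -/
def Crosses (H : Gadget) (e f : Sym2 H.V) : Prop :=
  e ∈ H.graph.edgeSet ∧ f ∈ H.graph.edgeSet ∧ e ≠ f ∧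
    ((H.arc e ∩ H.arc f) \ Set.range H.pos).Nonempty

/-- The positions of the vertices define a straight-line 1-planar drawing. -/
structure Straight (H : Gadget) : Prop where
  pos_injective : Function.Injective H.pos
  vertex : ∀ e ∈ H.graph.edgeSet, ∀ w, H.pos w ∈ H.arc e → w ∈ e
  disjoint : ∀ e f, H.Crosses e f → ∀ w ∈ e, w ∉ f
  once : ∀ e f, H.Crosses e f → (H.arc e ∩ H.arc f).Subsingleton
  onePlanar : ∀ e f g, H.Crosses e f → H.Crosses e g → f = g

/-- The drawing defined by the positions of the vertices. -/
def Straight.drawing {H : Gadget} (h : H.Straight) : Drawing H.graph where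
  pos := H.pos
  pos_injective := h.pos_injective
  arc := H.arc
  arc_isArc u v huv := ⟨Path.segment _ _,
    Path.segment_injective_of_ne (fun heq => huv.ne (h.pos_injective heq)), Path.range_segment _ _⟩
  arc_vertex := h.vertex
  cross_disjoint e he f hf hne hz := h.disjoint e f ⟨he, hf, hne, hz⟩
  cross_once e he f hf hne := by
    intro x hx y hy
    exact h.once e f ⟨he, hf, hne, x, hx⟩ hx.1 hy.1

/-- The crossings are almost full, and their sides are not crossed. -/
def LocallyMaximal (H : Gadget) : Prop :=
  ∀ e f, H.Crosses e f → AlmostFullPair H.graph e f ∧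
    ∀ u ∈ e, ∀ x ∈ f, ∀ g, ¬ H.Crosses s(u, x) g

/-- The gadget has a 1-planar straight-line drawing in `K`, with its roots at given points, or else
it is a single vertex at `o`. -/
structure Fits (H : Gadget) (K : Set (ℝ × ℝ)) (o : ℝ × ℝ) (corner : Fin 5 → ℝ × ℝ) : Prop where
  straight : H.Straight
  pos_mem : ∀ v, H.pos v ∈ K
  pos_root : ∃ β : Bool, (∀ i, H.pos (H.root i) = if β then corner i else o) ∧
    (β = false → Subsingleton H.V)

theorem not_crosses_point {o : ℝ × ℝ} {e f : Sym2 (point o).V} : ¬ (point o).Crosses e f := by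
  rintro ⟨he, -⟩
  simp only [point, SimpleGraph.edgeSet_bot] at he
  exact he.elim

theorem fits_point {K : Set (ℝ × ℝ)} {o : ℝ × ℝ} {corner : Fin 5 → ℝ × ℝ} (ho : o ∈ K) :
    (point o).Fits K o corner where
  straight :=
    { pos_injective := fun _ _ _ => rfl
      vertex := fun e he => by
        simp only [point, SimpleGraph.edgeSet_bot] at he
        exact he.elim
      disjoint := fun _ _ h => (not_crosses_point h).elim
      once := fun _ _ h => (not_crosses_point h).elim
      onePlanar := fun _ _ _ h => (not_crosses_point h).elim }
  pos_mem _ := ho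
  pos_root := ⟨false, fun _ => rfl, fun _ => inferInstanceAs (Subsingleton Unit)⟩

theorem locallyMaximal_point (o : ℝ × ℝ) : (point o).LocallyMaximal :=
  fun _ _ h => (not_crosses_point h).elim

end Gadget

/-- Four vertices, all pairs of which but the first are adjacent, induce a `K₄` minus an edge. -/
theorem almostFullPair_of_adj {V : Type*} {G : SimpleGraph V} {u v x y : V} (huv : G.Adj u v)
    (hxy : G.Adj x y) (hux : G.Adj u x) (hxv : G.Adj x v) (huy : G.Adj u y) (hne : v ≠ y)
    (hvy : ¬ G.Adj v y) : AlmostFullPair G s(u, v) s(x, y) := by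
  have hmem : ∀ i : Fin 4, (![v, y, u, x] i) ∈ {w | w ∈ s(u, v) ∨ w ∈ s(x, y)} := by
    intro i
    fin_cases i <;> simp
  have hbij : Function.Bijective
      (fun i : Fin 4 => (⟨![v, y, u, x] i, hmem i⟩ : {w | w ∈ s(u, v) ∨ w ∈ s(x, y)})) := by
    constructor
    · intro i j hij
      rw [Subtype.mk.injEq] at hij
      fin_cases i <;> fin_cases j <;>
        simp [hne, huv.ne, hxy.ne, hux.ne, hxv.ne, huy.ne, hne.symm, huv.ne.symm, hxy.ne.symm,
          hux.ne.symm, hxv.ne.symm, huy.ne.symm] at hij ⊢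
    · rintro ⟨w, hw⟩
      simp only [Set.mem_ofPred_eq, Sym2.mem_iff] at hw
      rcases hw with (rfl | rfl) | (rfl | rfl)
      · exact ⟨2, rfl⟩
      · exact ⟨0, rfl⟩
      · exact ⟨3, rfl⟩
      · exact ⟨1, rfl⟩
  refine ⟨(RelIso.symm ⟨Equiv.ofBijective _ hbij, ?_⟩ :)⟩
  intro i j
  have hyv : ¬ G.Adj y v := fun h => hvy h.symm
  fin_cases i <;> fin_cases j <;>
    simp [K4Minus, hvy, hyv, huv, hxy, hux, hxv, huy, huv.symm, hxy.symm, hux.symm, hxv.symm,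
      huy.symm]

/-! ### Layouts of a frame, and crossings after insertion -/

namespace Frame

variable {S T : Type} (B : Frame S T)

/-- The possible end of the `i`-th edge at the site `t`. -/
noncomputable def port (o : ℝ × ℝ) (t : T) (i : Fin 5) (β : Bool) : ℝ × ℝ :=
  B.place t (if β then B.pos (B.root i) else o)

/-- The possible segment of the `i`-th edge at the site `t`. -/
noncomputable def spoke (o : ℝ × ℝ) (t : T) (i : Fin 5) (β : Bool) : Set (ℝ × ℝ) :=
  segment ℝ (B.pos (B.nb t i)) (B.port o t i β)

/-- The copy of the region `K` at the site `t`. -/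
def patch (K : Set (ℝ × ℝ)) (t : T) : Set (ℝ × ℝ) := B.place t '' K

/-- The frame is drawn in the convex region `K` with straight edges, so that only the pairs of
edges in `part` may cross, whatever is inserted at the sites. -/
structure Layout (K : Set (ℝ × ℝ)) (o : ℝ × ℝ) (part : T × Fin 5 → T × Fin 5 → Prop) :
    Prop where
  convex : Convex ℝ K
  mem : o ∈ K
  place_injective : ∀ t, Function.Injective (B.place t)
  pos_injective : Function.Injective B.pos
  pos_mem : ∀ a, B.pos a ∈ K
  patch_subset : ∀ t, B.patch K t ⊆ K
  rim_rim : ∀ a b c d, B.graph.Adj a b → B.graph.Adj c d → s(a, b) ≠ s(c, d) →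
    segment ℝ (B.pos a) (B.pos b) ∩ segment ℝ (B.pos c) (B.pos d) ⊆ Set.range B.pos
  rim_spoke : ∀ a b t i β, B.graph.Adj a b →
    segment ℝ (B.pos a) (B.pos b) ∩ B.spoke o t i β ⊆ Set.range B.pos
  spoke_spoke : ∀ t t' i j β β', t ≠ t' → ¬ part (t, i) (t', j) →
    B.spoke o t i β ∩ B.spoke o t' j β' ⊆ Set.range B.pos
  spoke_own : ∀ t i j β, i ≠ j → B.spoke o t i β ∩ B.spoke o t j β ⊆ {B.port o t i β}
  once : ∀ t t' i j β β', part (t, i) (t', j) →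
    (B.spoke o t i β ∩ B.spoke o t' j β').Subsingleton
  rim_patch : ∀ a b t, B.graph.Adj a b →
    Disjoint (segment ℝ (B.pos a) (B.pos b)) (B.patch K t)
  patch_patch : ∀ t t', t ≠ t' → Disjoint (B.patch K t) (B.patch K t')
  spoke_patch : ∀ t t' i β, t ≠ t' → Disjoint (B.spoke o t i β) (B.patch K t')
  spoke_own_patch : ∀ t i, B.spoke o t i true ∩ B.patch K t ⊆ {B.port o t i true}
  pos_patch : ∀ a t, B.pos a ∉ B.patch K t
  pos_rim : ∀ a b c, B.graph.Adj a b → B.pos c ∈ segment ℝ (B.pos a) (B.pos b) → c = a ∨ c = b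
  pos_spoke : ∀ c t i β, B.pos c ∈ B.spoke o t i β → c = B.nb t i
  part_symm : ∀ p q, part p q → part q p
  part_unique : ∀ p q r, part p q → part p r → q = r
  part_ne : ∀ p q, part p q → p.1 ≠ q.1
  part_adj : ∀ p q, part p q → B.graph.Adj (B.nb p.1 p.2) (B.nb q.1 q.2)
  part_side : ∀ p q, part p q → ∃ j, B.nb p.1 j = B.nb q.1 q.2 ∧ ∀ r, ¬ part (p.1, j) r

variable {B} [Fintype S] [DecidableEq S] [Fintype T] [DecidableEq T] {H : T → Gadget}
  {K : Set (ℝ × ℝ)} {o : ℝ × ℝ} {part : T × Fin 5 → T × Fin 5 → Prop}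

/-- The edge of the plugged frame that joins the frame to a root of an inserted gadget. -/
def link (B : Frame S T) (H : T → Gadget) (p : T × Fin 5) : Sym2 (B.plug H).V :=
  s(.inl (B.nb p.1 p.2), .inr ⟨p.1, (H p.1).root p.2⟩)

/-- A pair of vertices of an inserted gadget, in the plugged frame. -/
def lift (B : Frame S T) (H : T → Gadget) (t : T) (e : Sym2 (H t).V) : Sym2 (B.plug H).V :=
  e.map fun v => .inr ⟨t, v⟩

theorem edge_cases {e : Sym2 (B.plug H).V} (he : e ∈ (B.plug H).graph.edgeSet) :
    (∃ a b, B.graph.Adj a b ∧ e = s(.inl a, .inl b)) ∨ (∃ t i, e = B.link H (t, i)) ∨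
      ∃ t e', e' ∈ (H t).graph.edgeSet ∧ e = B.lift H t e' := by
  induction e using Sym2.ind with
  | _ x y =>
    have h : B.PlugAdj H x y := he
    cases h with
    | skeleton h => exact .inl ⟨_, _, h, rfl⟩
    | link t i => exact .inr (.inl ⟨t, i, rfl⟩)
    | link_symm t i => exact .inr (.inl ⟨t, i, Sym2.eq_swap⟩)
    | @inner t u v h => exact .inr (.inr ⟨t, s(u, v), h, rfl⟩)

theorem arc_lift (t : T) (e : Sym2 (H t).V) :
    (B.plug H).arc (B.lift H t e) = B.place t '' (H t).arc e := by
  induction e using Sym2.ind with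
  | _ u v => exact (image_segment ℝ (B.place t) _ _).symm

theorem mem_lift {t : T} {e : Sym2 (H t).V} {x : (B.plug H).V} :
    x ∈ B.lift H t e ↔ ∃ v ∈ e, x = .inr ⟨t, v⟩ := by
  simp [lift, Sym2.mem_map, eq_comm]

theorem lift_mem_edgeSet {t : T} {e : Sym2 (H t).V} :
    B.lift H t e ∈ (B.plug H).graph.edgeSet ↔ e ∈ (H t).graph.edgeSet := by
  induction e using Sym2.ind with
  | _ u v =>
    constructor
    · intro h
      rcases exists_eq_inl_of_adj (B := B) (H := H) (t := t) (v := u) h with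
        ⟨a, ha, -⟩ | ⟨w, hw, huw⟩
      · simp at ha
      · obtain rfl : v = w := by simpa using hw
        exact huw
    · exact fun h => PlugAdj.inner t h

theorem lift_injective (t : T) : Function.Injective (B.lift H t) :=
  Sym2.map.injective fun u v h => by simpa using h

/-- One `β` serves all five links of a site: they end at the five corners of the small pentagon, or
all at its centre when the gadget is a point. -/
theorem arc_link
    (hH : ∀ t, (H t).Fits K o fun i => B.pos (B.root i)) (t : T) :
    ∃ β : Bool, (∀ i, (B.plug H).arc (B.link H (t, i)) = B.spoke o t i β ∧
      B.port o t i β = (B.plug H).pos (.inr ⟨t, (H t).root i⟩)) ∧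
      (β = false → Subsingleton (H t).V) := by
  obtain ⟨β, h1, h2⟩ := (hH t).pos_root
  have hport : ∀ i, B.port o t i β = (B.plug H).pos (.inr ⟨t, (H t).root i⟩) := fun i => by
    simp only [port, Sum.elim_inr, h1 i]
  refine ⟨β, fun i => ⟨?_, hport i⟩, h2⟩
  rw [spoke, hport]
  rfl

theorem arc_subset_convex {H : Gadget} (hK : Convex ℝ K) (hH : ∀ v, H.pos v ∈ K)
    (e : Sym2 H.V) : H.arc e ⊆ K := by
  induction e using Sym2.ind with
  | _ u v => exact hK.segment_subset (hH u) (hH v)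

theorem Layout.arc_lift_subset (hB : B.Layout K o part)
    (hH : ∀ t, (H t).Fits K o fun i => B.pos (B.root i)) (t : T) (e : Sym2 (H t).V) :
    (B.plug H).arc (B.lift H t e) ⊆ B.patch K t := by
  rw [arc_lift]
  exact Set.image_mono (arc_subset_convex hB.convex (hH t).pos_mem e)

/-- Two edges of the plugged frame cross only if they do so in an inserted gadget, or if they are
edges between the frame and the gadgets that are designated as partners. -/
theorem Layout.crosses_plug (hB : B.Layout K o part)
    (hH : ∀ t, (H t).Fits K o fun i => B.pos (B.root i)) {e f : Sym2 (B.plug H).V}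
    (h : (B.plug H).Crosses e f) :
    (∃ t e' f', e = B.lift H t e' ∧ f = B.lift H t f' ∧ (H t).Crosses e' f') ∨
      ∃ p q, part p q ∧ e = B.link H p ∧ f = B.link H q := by
  have hrange : Set.range B.pos ⊆ Set.range (B.plug H).pos := by
    rintro _ ⟨a, rfl⟩
    exact ⟨.inl a, rfl⟩
  have rim_link : ∀ a b t i, B.graph.Adj a b → ∀ z, z ∈ segment ℝ (B.pos a) (B.pos b) →
      z ∈ (B.plug H).arc (B.link H (t, i)) → z ∈ Set.range (B.plug H).pos := by
    intro a b t i hab z hz hz'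
    obtain ⟨β, hβ, -⟩ := arc_link hH t
    rw [(hβ i).1] at hz'
    exact hrange (hB.rim_spoke a b t i β hab ⟨hz, hz'⟩)
  have rim_lift : ∀ a b t e', B.graph.Adj a b → ∀ z, z ∈ segment ℝ (B.pos a) (B.pos b) →
      z ∈ (B.plug H).arc (B.lift H t e') → False := by
    intro a b t e' hab z hz hz'
    exact Set.disjoint_left.1 (hB.rim_patch a b t hab) hz (hB.arc_lift_subset hH t e' hz')
  have link_lift : ∀ t i t' e', e' ∈ (H t').graph.edgeSet → ∀ z,
      z ∈ (B.plug H).arc (B.link H (t, i)) →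
      z ∈ (B.plug H).arc (B.lift H t' e') → z ∈ Set.range (B.plug H).pos := by
    intro t i t' e' he' z hz hz'
    have hz'' := hB.arc_lift_subset hH t' e' hz'
    obtain ⟨β, hβ, hsub⟩ := arc_link hH t
    rw [(hβ i).1] at hz
    by_cases htt : t = t'
    · subst htt
      -- If the links run to the centre, the gadget is a single vertex and has no edge that could be
      -- met.
      cases β with
      | false =>
        have := hsub rfl
        induction e' using Sym2.ind with
        | _ u v => exact (SimpleGraph.Adj.ne he' (Subsingleton.elim u v)).elim
      | true =>
        have := hB.spoke_own_patch t i ⟨hz, hz''⟩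
        rw [(hβ i).2] at this
        exact ⟨_, this.symm⟩
    · exact (Set.disjoint_left.1 (hB.spoke_patch t t' i β htt) hz hz'').elim
  obtain ⟨he, hf, hne, z, ⟨hze, hzf⟩, hz⟩ := h
  rcases edge_cases he with ⟨a, b, hab, rfl⟩ | ⟨t, i, rfl⟩ | ⟨t, e', he', rfl⟩ <;>
    rcases edge_cases hf with ⟨c, d, hcd, rfl⟩ | ⟨t', j, rfl⟩ | ⟨t', f', hf', rfl⟩
  · refine (hz (hrange (hB.rim_rim a b c d hab hcd (fun h => hne ?_) ⟨hze, hzf⟩))).elim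
    have := congrArg (Sym2.map (fun x => (.inl x : (B.plug H).V))) h
    simpa using this
  · exact (hz (rim_link a b t' j hab z hze hzf)).elim
  · exact (rim_lift a b t' f' hab z hze hzf).elim
  · exact (hz (rim_link c d t i hcd z hzf hze)).elim
  · obtain ⟨β, hβ, hsub⟩ := arc_link hH t
    obtain ⟨β', hβ', hsub'⟩ := arc_link hH t'
    have hze' := hze
    have hzf' := hzf
    rw [(hβ i).1] at hze'
    by_cases htt : t = t'
    · subst htt
      rw [(hβ j).1] at hzf'
      have hij : i ≠ j := by
        rintro rfl
        exact hne rfl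
      have := hB.spoke_own t i j β hij ⟨hze', hzf'⟩
      rw [(hβ i).2] at this
      exact (hz ⟨_, this.symm⟩).elim
    · rw [(hβ' j).1] at hzf'
      by_cases hp : part (t, i) (t', j)
      · exact .inr ⟨_, _, hp, rfl, rfl⟩
      · exact (hz (hrange (hB.spoke_spoke t t' i j β β' htt hp ⟨hze', hzf'⟩))).elim
  · exact (hz (link_lift t i t' f' hf' z hze hzf)).elim
  · exact (rim_lift c d t e' hcd z hzf hze).elim
  · exact (hz (link_lift t' j t e' he' z hzf hze)).elim
  · by_cases htt : t = t'
    · subst htt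
      refine .inl ⟨t, e', f', rfl, rfl, he', hf', fun h => hne (congrArg _ h), ?_⟩
      rw [arc_lift] at hze hzf
      obtain ⟨x, hx, rfl⟩ := hze
      obtain ⟨y, hy, hxy⟩ := hzf
      obtain rfl := hB.place_injective t hxy
      refine ⟨y, ⟨hx, hy⟩, ?_⟩
      rintro ⟨v, rfl⟩
      exact hz ⟨.inr ⟨t, v⟩, rfl⟩
    · exact (Set.disjoint_left.1 (hB.patch_patch t t' htt) (hB.arc_lift_subset hH t e' hze)
        (hB.arc_lift_subset hH t' f' hzf)).elim

end Frame

namespace Frame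

variable {S T : Type} {B : Frame S T} [Fintype S] [DecidableEq S] [Fintype T] [DecidableEq T]
  {H : T → Gadget}
  {K : Set (ℝ × ℝ)} {o : ℝ × ℝ} {part : T × Fin 5 → T × Fin 5 → Prop}

theorem site_eq_of_lift_eq {t t' : T} {e : Sym2 (H t).V} {e' : Sym2 (H t').V}
    (h : B.lift H t e = B.lift H t' e') : t = t' := by
  induction e using Sym2.ind with
  | _ u v =>
    have hu : (.inr ⟨t, u⟩ : (B.plug H).V) ∈ B.lift H t s(u, v) := mem_lift.2 ⟨u, by simp, rfl⟩
    rw [h, mem_lift] at hu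
    obtain ⟨w, -, hw⟩ := hu
    simp only [Sum.inr.injEq, Sigma.mk.injEq] at hw
    exact hw.1

theorem mem_link {p : T × Fin 5} {x : (B.plug H).V} :
    x ∈ B.link H p ↔ x = .inl (B.nb p.1 p.2) ∨ x = .inr ⟨p.1, (H p.1).root p.2⟩ := by
  simp [link]

theorem link_ne_lift {p : T × Fin 5} {t : T} {e : Sym2 (H t).V} : B.link H p ≠ B.lift H t e := by
  intro h
  have := mem_link.2 (.inl rfl : (.inl (B.nb p.1 p.2) : (B.plug H).V) = _ ∨ _)
  rw [h, mem_lift] at this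
  obtain ⟨w, -, hw⟩ := this
  simp at hw

theorem link_injective : Function.Injective (B.link H) := by
  rintro ⟨t, i⟩ ⟨t', j⟩ h
  have h1 : (.inl (B.nb t i) : (B.plug H).V) ∈ B.link H (t, i) := mem_link.2 (.inl rfl)
  have h2 : (.inr ⟨t, (H t).root i⟩ : (B.plug H).V) ∈ B.link H (t, i) := mem_link.2 (.inr rfl)
  rw [h, mem_link] at h1 h2
  obtain rfl : t = t' := by
    simp only [reduceCtorEq, Sum.inr.injEq, Sigma.mk.injEq, false_or] at h2
    exact h2.1
  have h3 : B.nb t i = B.nb t j := by simpa using h1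
  rw [B.nb_injective t h3]

/-- A crossing inside a gadget is an affine image of one there, and all others are between partner
links; so each property of crossings comes from the gadgets or from the layout. -/
theorem Layout.straight_plug (hB : B.Layout K o part)
    (hH : ∀ t, (H t).Fits K o fun i => B.pos (B.root i)) : (B.plug H).Straight where
  pos_injective := by
    have hmem : ∀ t v, (B.plug H).pos (.inr ⟨t, v⟩) ∈ B.patch K t := fun t v =>
      ⟨_, (hH t).pos_mem v, rfl⟩
    rintro (a | ⟨t, v⟩) (b | ⟨t', v'⟩) h
    · rw [hB.pos_injective h]
    · exact (hB.pos_patch a t' (by rw [show B.pos a = _ from h]; exact hmem _ _)).elim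
    · exact (hB.pos_patch b t (by rw [show B.pos b = _ from h.symm]; exact hmem _ _)).elim
    · by_cases htt : t = t'
      · subst htt
        have hv : v = v' := (hH t).straight.pos_injective (hB.place_injective t h)
        rw [hv]
      · exact (Set.disjoint_left.1 (hB.patch_patch t t' htt) (hmem t v) (h ▸ hmem t' v')).elim
  vertex := by
    have hmem : ∀ t v, (B.plug H).pos (.inr ⟨t, v⟩) ∈ B.patch K t := fun t v =>
      ⟨_, (hH t).pos_mem v, rfl⟩
    intro e he w hw
    rcases edge_cases he with ⟨a, b, hab, rfl⟩ | ⟨t, i, rfl⟩ | ⟨t, e', he', rfl⟩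
    · rcases w with c | ⟨t, v⟩
      · rcases hB.pos_rim a b c hab hw with rfl | rfl <;> simp
      · exact (Set.disjoint_left.1 (hB.rim_patch a b t hab) hw (hmem t v)).elim
    · obtain ⟨β, hβ, hsub⟩ := arc_link (B := B) hH t
      rw [(hβ i).1] at hw
      rcases w with c | ⟨t', v⟩
      · rw [hB.pos_spoke c t i β hw]
        exact mem_link.2 (.inl rfl)
      · by_cases htt : t = t'
        · subst htt
          refine mem_link.2 (.inr ?_)
          cases β with
          | false =>
            have := hsub rfl
            rw [Subsingleton.elim v ((H t).root i)]
          | true =>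
            have := hB.spoke_own_patch t i ⟨hw, hmem t v⟩
            rw [(hβ i).2] at this
            have hv : v = (H t).root i :=
              (hH t).straight.pos_injective (hB.place_injective t this)
            rw [hv]
        · exact (Set.disjoint_left.1 (hB.spoke_patch t t' i β htt) hw (hmem t' v)).elim
    · have hw' := hB.arc_lift_subset hH t e' hw
      rcases w with c | ⟨t', v⟩
      · exact (hB.pos_patch c t hw').elim
      · by_cases htt : t = t'
        · subst htt
          rw [arc_lift] at hw
          obtain ⟨x, hx, hxv⟩ := hw
          rw [hB.place_injective t (hxv : B.place t x = B.place t ((H t).pos v))] at hx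
          exact mem_lift.2 ⟨v, (hH t).straight.vertex e' he' v hx, rfl⟩
        · exact (Set.disjoint_left.1 (hB.patch_patch t t' htt) hw' (hmem t' v)).elim
  disjoint := by
    intro e f h w hwe hwf
    rcases hB.crosses_plug hH h with ⟨t, e', f', rfl, rfl, h'⟩ | ⟨p, q, hpq, rfl, rfl⟩
    · obtain ⟨v, hv, rfl⟩ := mem_lift.1 hwe
      obtain ⟨v', hv', hvv⟩ := mem_lift.1 hwf
      obtain rfl : v = v' := by simpa using hvv
      exact (hH t).straight.disjoint e' f' h' v hv hv'
    · have h1 := (hB.part_adj p q hpq).ne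
      have h2 := hB.part_ne p q hpq
      rcases mem_link.1 hwe with rfl | rfl <;> rcases mem_link.1 hwf with h3 | h3
      · exact h1 (by simpa using h3)
      · simp at h3
      · simp at h3
      · simp only [Sum.inr.injEq, Sigma.mk.injEq] at h3
        exact h2 h3.1
  once := by
    intro e f h
    rcases hB.crosses_plug hH h with ⟨t, e', f', rfl, rfl, h'⟩ | ⟨⟨t, i⟩, ⟨t', j⟩, hpq, rfl, rfl⟩
    · rw [arc_lift, arc_lift, ← Set.image_inter (hB.place_injective t)]
      exact ((hH t).straight.once e' f' h').image _
    · obtain ⟨β, hβ, -⟩ := arc_link (B := B) hH t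
      obtain ⟨β', hβ', -⟩ := arc_link (B := B) hH t'
      rw [(hβ i).1, (hβ' j).1]
      exact hB.once t t' i j β β' hpq
  onePlanar := by
    intro e f g h1 h2
    rcases hB.crosses_plug hH h1 with ⟨t, e', f', rfl, rfl, h1'⟩ | ⟨p, q, hpq, rfl, rfl⟩ <;>
      rcases hB.crosses_plug hH h2 with ⟨t', e'', g', he, rfl, h2'⟩ | ⟨p', r, hpr, he, rfl⟩
    · obtain rfl := site_eq_of_lift_eq he
      obtain rfl := lift_injective t he
      rw [(hH t).straight.onePlanar _ _ _ h1' h2']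
    · exact (link_ne_lift he.symm).elim
    · exact (link_ne_lift he).elim
    · obtain rfl := link_injective he
      rw [hB.part_unique _ _ _ hpq hpr]

theorem Layout.fits_plug (hB : B.Layout K o part)
    (hH : ∀ t, (H t).Fits K o fun i => B.pos (B.root i)) :
    (B.plug H).Fits K o fun i => B.pos (B.root i) where
  straight := hB.straight_plug hH
  pos_mem := by
    rintro (a | ⟨t, v⟩)
    · exact hB.pos_mem a
    · exact hB.patch_subset t ⟨_, (hH t).pos_mem v, rfl⟩
  pos_root := ⟨true, fun i => rfl, by simp⟩

theorem Layout.not_crosses_of_link (hB : B.Layout K o part)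
    (hH : ∀ t, (H t).Fits K o fun i => B.pos (B.root i)) {p : T × Fin 5}
    (hp : ∀ q, ¬ part p q) (g : Sym2 (B.plug H).V) : ¬ (B.plug H).Crosses (B.link H p) g := by
  intro h
  rcases hB.crosses_plug hH h with ⟨t, e', f', he, -, -⟩ | ⟨p', q, hpq, he, -⟩
  · exact link_ne_lift he
  · rw [link_injective he] at hp
    exact hp q hpq

/-- Crossings inside a gadget are inherited. At a crossing of partner links, `hpart` makes both
gadgets single vertices, so the uncrossed link that joins a site to the other link's skeleton end
leaves from the very end of the crossed link. With two distinct roots this side would be missing. -/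
theorem Layout.locallyMaximal_plug (hB : B.Layout K o part)
    (hH : ∀ t, (H t).Fits K o fun i => B.pos (B.root i)) (hmax : ∀ t, (H t).LocallyMaximal)
    (hpart : ∀ t i q, part (t, i) q → Subsingleton (H t).V) : (B.plug H).LocallyMaximal := by
  intro e f h
  rcases hB.crosses_plug hH h with ⟨t, e', f', rfl, rfl, h'⟩ | ⟨⟨t, i⟩, ⟨t', i'⟩, hpq, rfl, rfl⟩
  · obtain ⟨⟨ψ⟩, hside⟩ := hmax t e' f' h'
    constructor
    · have hset : {w | w ∈ B.lift H t e' ∨ w ∈ B.lift H t f'} =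
          (fun v => (.inr ⟨t, v⟩ : (B.plug H).V)) '' {w | w ∈ e' ∨ w ∈ f'} := by
        ext x
        change x ∈ B.lift H t e' ∨ x ∈ B.lift H t f' ↔ _
        rw [mem_lift, mem_lift]
        constructor
        · rintro (⟨v, hv, rfl⟩ | ⟨v, hv, rfl⟩)
          · exact ⟨v, .inl hv, rfl⟩
          · exact ⟨v, .inr hv, rfl⟩
        · rintro ⟨v, hv | hv, rfl⟩
          · exact .inl ⟨v, hv, rfl⟩
          · exact .inr ⟨v, hv, rfl⟩
      have hinj : Function.Injective (fun v => (.inr ⟨t, v⟩ : (B.plug H).V)) :=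
        fun u v huv => by simpa using huv
      rw [AlmostFullPair, hset]
      refine ⟨RelIso.trans (RelIso.symm ⟨Equiv.Set.image _ _ hinj, ?_⟩) ψ⟩
      rintro ⟨u, hu⟩ ⟨v, hv⟩
      exact lift_mem_edgeSet (B := B) (e := s(u, v))
    · intro u hu x hx g hg
      obtain ⟨u', hu', rfl⟩ := mem_lift.1 hu
      obtain ⟨x', hx', rfl⟩ := mem_lift.1 hx
      rcases hB.crosses_plug hH hg with ⟨t', e'', g', he, rfl, h''⟩ | ⟨p', r, -, he, -⟩
      · have he' : B.lift H t s(u', x') = B.lift H t' e'' := he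
        obtain rfl := site_eq_of_lift_eq he'
        obtain rfl := lift_injective t he'
        exact hside u' hu' x' hx' g' h''
      · exact link_ne_lift (he.symm.trans (rfl : _ = B.lift H t s(u', x')))
  · have hqp := hB.part_symm _ _ hpq
    have hsub := hpart t i _ hpq
    have hsub' := hpart t' i' _ hqp
    have hne : t ≠ t' := hB.part_ne _ _ hpq
    have hadj := hB.part_adj _ _ hpq
    obtain ⟨j, hj, hjr⟩ := hB.part_side _ _ hpq
    obtain ⟨j', hj', hjr'⟩ := hB.part_side _ _ hqp
    have hroot : (H t).root i = (H t).root j := Subsingleton.elim _ _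
    have hroot' : (H t').root i' = (H t').root j' := Subsingleton.elim _ _
    have hlink : B.link H (t, j) = s(.inl (B.nb t' i'), .inr ⟨t, (H t).root i⟩) := by
      rw [link, hroot]
      exact congrArg (fun a => s((.inl a : (B.plug H).V), _)) hj
    have hlink' : B.link H (t', j') = s(.inl (B.nb t i), .inr ⟨t', (H t').root i'⟩) := by
      rw [link, hroot']
      exact congrArg (fun a => s((.inl a : (B.plug H).V), _)) hj'
    have hlinkadj : ∀ p, B.link H p ∈ (B.plug H).graph.edgeSet := fun p => PlugAdj.link p.1 p.2
    -- This is the missing edge of the `K₄`: vertices at different sites are never adjacent.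
    have hvy : ¬ (B.plug H).graph.Adj (.inr ⟨t, (H t).root i⟩) (.inr ⟨t', (H t').root i'⟩) := by
      intro h
      rcases exists_eq_inl_of_adj h with ⟨a, ha, -⟩ | ⟨u, hu, -⟩
      · simp at ha
      · simp only [Sum.inr.injEq, Sigma.mk.injEq] at hu
        exact hne hu.1.symm
    constructor
    · refine almostFullPair_of_adj (hlinkadj (t, i)) (hlinkadj (t', i')) (.skeleton hadj) ?_ ?_ ?_
        hvy
      · rw [← SimpleGraph.mem_edgeSet, ← hlink]
        exact hlinkadj _
      · rw [← SimpleGraph.mem_edgeSet, ← hlink']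
        exact hlinkadj _
      · simp only [ne_eq, Sum.inr.injEq, Sigma.mk.injEq, not_and]
        exact fun h => (hne h).elim
    · intro u hu x hx g hg
      rcases mem_link.1 hu with rfl | rfl <;> rcases mem_link.1 hx with rfl | rfl
      · rcases hB.crosses_plug hH hg with ⟨t, e', f', he, -, -⟩ | ⟨p', q, -, he, -⟩
        · have : (.inl (B.nb t' i') : (B.plug H).V) ∈ B.lift H t e' := by
            rw [← he]
            simp
          obtain ⟨w, -, hw⟩ := mem_lift.1 this
          simp at hw
        · have : (.inr ⟨p'.1, (H p'.1).root p'.2⟩ : (B.plug H).V) ∈ B.link H p' :=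
            mem_link.2 (.inr rfl)
          rw [← he] at this
          simp at this
      · exact hB.not_crosses_of_link hH hjr' g (hlink' ▸ hg)
      · exact hB.not_crosses_of_link hH hjr g (by
          rw [hlink, Sym2.eq_swap]
          exact hg)
      · exact hvy hg.1

end Frame

/-! ### The concrete frame: coordinates and finite checks -/

namespace Nest

/-- The successor of a vertex on its cycle. The cycles have the lengths 5, 5, 10 and 5. -/
def next (a : Fin 25) : Fin 25 :=
  Fin.ofNat 25 (List.getD [
    1, 2, 3, 4, 0, 6, 7, 8, 9, 5, 11, 12, 13, 14, 15, 16, 17, 18, 19, 10, 21, 22, 23, 24, 20] a 0)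

/-- The positions of the vertices. -/
def vert (a : Fin 25) : ℕ × ℕ :=
  List.getD [
    (1900, 3800), (100, 2500), (800, 400), (3000, 400), (3700, 2500), (1204, 2856), (786, 1542),
    (1895, 720), (3015, 1537), (2598, 2854), (1317, 2328), (1178, 1906), (1313, 1471),
    (1678, 1207), (2123, 1213), (2487, 1482), (2628, 1894), (2489, 2325), (2121, 2592),
    (1683, 2584), (1635, 2264), (1465, 1753), (1894, 1438), (2338, 1761), (2162, 2269)] a (0, 0)

/-- The lower left corners of the boxes around the sites. -/
def box (t : Fin 27) : ℕ × ℕ :=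
  List.getD [
    (476, 2336), (1010, 687), (2746, 684), (3107, 1488), (2641, 2927), (1124, 2923), (1188, 2381),
    (1030, 1878), (1195, 1379), (1615, 1062), (2145, 1070), (2577, 1373), (2732, 1885),
    (2578, 2382), (2140, 2699), (1616, 2699), (1425, 2218), (1311, 1883), (1424, 1543),
    (1703, 1337), (2060, 1340), (2344, 1546), (2454, 1875), (2343, 2213), (2062, 2429),
    (1705, 2423), (1881, 1881)] t (0, 0)

/-- The corners of a pentagon in the box around the origin. -/
def spike (i : Fin 5) : ℕ × ℕ :=
  List.getD [(19, 38), (1, 25), (8, 4), (30, 4), (37, 25)] i (0, 0)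

/-- The neighbours of the sites, in the order of the corners of the pentagon. -/
def nbr (t : Fin 27) (i : Fin 5) : Fin 25 :=
  Fin.ofNat 25 (List.getD (List.getD [
    [0, 1, 2, 6, 5], [6, 1, 2, 3, 7], [8, 7, 2, 3, 4], [9, 8, 7, 3, 4], [0, 5, 9, 8, 4],
    [0, 1, 6, 5, 9], [19, 5, 6, 11, 10], [5, 6, 12, 11, 10], [12, 11, 6, 7, 13],
    [12, 6, 7, 14, 13], [15, 14, 13, 7, 8], [15, 14, 7, 8, 16], [9, 17, 16, 15, 8],
    [18, 17, 16, 8, 9], [9, 5, 19, 18, 17], [5, 10, 19, 18, 9], [19, 10, 11, 21, 20],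
    [10, 11, 12, 21, 20], [21, 11, 12, 13, 22], [21, 12, 13, 14, 22], [23, 22, 13, 14, 15],
    [23, 22, 14, 15, 16], [17, 24, 23, 15, 16], [18, 24, 23, 16, 17], [18, 19, 20, 24, 17],
    [19, 10, 20, 24, 18], [24, 20, 21, 22, 23]] t []) i 0)

/-- The partner in a crossing of the `i`-th edge at the site `t`; an edge without crossing is its
own partner. The pair `(t, i)` is represented by `5 * t + i`. -/
def partner (p : Fin 27 × Fin 5) : Fin 27 × Fin 5 :=
  let v := List.getD [
    26, 1, 6, 3, 27, 5, 2, 7, 12, 9, 17, 11, 8, 13, 18, 23, 16, 10, 14, 19, 20, 29, 22, 15, 24,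
    25, 0, 4, 28, 21, 76, 31, 35, 39, 34, 32, 36, 41, 38, 33, 40, 37, 42, 46, 45, 44, 43, 47, 52,
    49, 56, 51, 48, 53, 57, 55, 50, 54, 58, 63, 68, 67, 62, 59, 64, 74, 66, 61, 60, 69, 70, 79,
    78, 73, 65, 75, 30, 77, 72, 71, 126, 81, 85, 89, 84, 82, 86, 91, 88, 83, 90, 87, 92, 96, 95,
    94, 93, 97, 102, 99, 106, 101, 98, 103, 107, 105, 100, 104, 108, 113, 118, 117, 112, 109, 114,
    124, 116, 111, 110, 119, 120, 129, 128, 123, 115, 125, 80, 127, 122, 121, 130, 131, 132, 133,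
    134] (5 * p.1.val + p.2.val) 0
  (Fin.ofNat 27 (v / 5), Fin.ofNat 5 (v % 5))

/-- Disjoint paths between two vertices of the outermost cycle, without the end vertices. Here and
in `fan`, a number from 25 on represents a site. -/
def ladder : List ((Fin 25 × Fin 25) × List (List ℕ)) :=
  [
    ((0, 2), [[1], [4, 3], [25], [29, 8, 27], [30, 6, 26]]),
    ((0, 3), [[1, 26], [4], [25, 2], [29, 8, 27], [30, 9, 28]]),
    ((1, 3), [[0, 4], [2], [25, 6, 7, 27], [26], [30, 9, 28]]),
    ((1, 4), [[0], [2, 27], [25, 5, 29], [26, 3], [30, 9, 28]]),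
    ((2, 4), [[1, 0], [3], [25, 5, 29], [26, 7, 28], [27]])]

/-- Disjoint paths from a vertex to vertices with smaller numbers, without the starting vertex. -/
def fan (a : Fin 25) : List (List ℕ) :=
  List.getD [[], [], [], [], [],
    [[6, 26, 2], [9, 28, 3], [25, 0], [29, 4], [30, 1]],
    [[5], [7, 27, 3], [25, 2], [26, 1], [30, 0]], [[6], [8, 29, 0], [26, 1], [27, 2], [28, 3]],
    [[7], [9, 5], [27, 2], [28, 3], [29, 0]], [[5], [8], [28, 3], [29, 0], [30, 1]],
    [[32, 6], [40, 9], [11, 33, 7], [19, 18, 38, 8], [31, 5]],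
    [[32, 6], [33, 7], [10], [12, 13, 35, 8], [31, 5]],
    [[32, 5], [33, 6], [34, 7], [42, 10], [11]], [[33, 6], [34, 7], [35, 8], [43, 11], [12]],
    [[34, 6], [35, 7], [36, 8], [44, 12], [13]], [[35, 7], [36, 8], [37, 9], [45, 13], [14]],
    [[36, 7], [37, 8], [38, 9], [46, 14], [15]], [[37, 8], [38, 9], [39, 5], [47, 15], [16]],
    [[38, 8], [39, 5], [40, 9], [17], [19, 10]], [[39, 9], [41, 11], [10], [18], [31, 5]],
    [[41, 10], [42, 11], [49, 17], [50, 18], [21, 43, 12]],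
    [[41, 10], [42, 11], [43, 12], [44, 13], [20]],
    [[43, 11], [44, 12], [45, 13], [46, 14], [21]],
    [[45, 13], [46, 14], [47, 15], [48, 16], [22]], [[47, 15], [48, 16], [50, 10], [20], [23]]] a []

/-- The end of the `i`-th edge at the site `t`: a corner of the pentagon in the box of the site, or
the centre of the box. -/
def tip (t : Fin 27) (i : Fin 5) (β : Bool) : ℕ × ℕ :=
  bif β then ((box t).1 + (spike i).1, (box t).2 + (spike i).2)
  else ((box t).1 + 19, (box t).2 + 19)

/-- The points `a`, `b`, `c` are in counterclockwise position. -/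
def ccw (a b c : ℕ × ℕ) : Bool :=
  Nat.blt (a.2 * b.1 + b.2 * c.1 + c.2 * a.1) (a.1 * b.2 + b.1 * c.2 + c.1 * a.2)

/-- The points `a`, `b`, `c` are not on a line. -/
def bent (a b c : ℕ × ℕ) : Bool := ccw a b c || ccw b a c

/-- The points `c` and `d` are on the same side of the line through `a` and `b`. -/
def sameSide (a b c d : ℕ × ℕ) : Bool :=
  (ccw a b c && ccw a b d) || (ccw b a c && ccw b a d)

/-- One of two segments is on one side of the line through the other. -/
def apart (a b c d : ℕ × ℕ) : Bool := sameSide a b c d || sameSide c d a b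

/-- The points `c` and `d` are on different sides of the line through `a` and `b`. -/
def straddles (a b c d : ℕ × ℕ) : Bool :=
  (ccw a b c && ccw b a d) || (ccw b a c && ccw a b d)

/-- The segment from `a` to `b` is outside of the box with the lower left corner `g`. -/
def outside (g a b : ℕ × ℕ) : Bool :=
  (Nat.blt a.1 g.1 && Nat.blt b.1 g.1) || (Nat.blt a.2 g.2 && Nat.blt b.2 g.2) ||
  (Nat.blt (g.1 + 38) a.1 && Nat.blt (g.1 + 38) b.1) ||
  (Nat.blt (g.2 + 38) a.2 && Nat.blt (g.2 + 38) b.2) ||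
  (ccw a b g && ccw a b (g.1 + 38, g.2) && ccw a b (g.1, g.2 + 38) &&
    ccw a b (g.1 + 38, g.2 + 38)) ||
  (ccw b a g && ccw b a (g.1 + 38, g.2) && ccw b a (g.1, g.2 + 38) &&
    ccw b a (g.1 + 38, g.2 + 38))

/-- Here and in the next checks, two segments are harmless if a line through one of them misses the
other, or if they share an end and are not collinear. -/
theorem rim_rim_check : ∀ a c : Fin 25, a ≠ c →
    (apart (vert a) (vert (next a)) (vert c) (vert (next c)) ||
      (next a == c && bent (vert c) (vert a) (vert (next c))) ||
      (next c == a && bent (vert a) (vert c) (vert (next a)))) = true := by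
  decide +kernel

theorem rim_spoke_check : ∀ (a : Fin 25) (t : Fin 27) (i : Fin 5) (β : Bool),
    (apart (vert a) (vert (next a)) (vert (nbr t i)) (tip t i β) ||
      (nbr t i == a && bent (vert a) (vert (next a)) (tip t i β)) ||
      (nbr t i == next a && bent (vert (next a)) (vert a) (tip t i β))) = true := by
  decide +kernel

theorem spoke_spoke_check : ∀ (t t' : Fin 27), t < t' → ∀ (i j : Fin 5) (β β' : Bool),
    (apart (vert (nbr t i)) (tip t i β) (vert (nbr t' j)) (tip t' j β') ||
      (nbr t i == nbr t' j && bent (vert (nbr t i)) (tip t i β) (tip t' j β')) ||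
      partner (t, i) == (t', j)) = true := by
  decide +kernel

/-- Links to the centre share that end and must leave it in different directions; links to different
corners must be disjoint. -/
theorem spoke_own_check : ∀ (t : Fin 27) (i j : Fin 5), i ≠ j →
    (bent (tip t i false) (vert (nbr t i)) (vert (nbr t j)) &&
      apart (vert (nbr t i)) (tip t i true) (vert (nbr t j)) (tip t j true)) = true := by
  decide +kernel

theorem spoke_box_check : ∀ (t t' : Fin 27) (i : Fin 5) (β : Bool), t ≠ t' →
    outside (box t') (vert (nbr t i)) (tip t i β) = true := by
  decide +kernel

theorem rim_box_check : ∀ (a : Fin 25) (t : Fin 27),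
    outside (box t) (vert a) (vert (next a)) = true := by
  decide +kernel

theorem box_box_check : ∀ (t t' : Fin 27), t ≠ t' →
    (Nat.blt ((box t).1 + 38) (box t').1 || Nat.blt ((box t').1 + 38) (box t).1 ||
      Nat.blt ((box t).2 + 38) (box t').2 || Nat.blt ((box t').2 + 38) (box t).2) = true := by
  decide +kernel

theorem pos_rim_check : ∀ a c : Fin 25,
    (c == a || c == next a || bent (vert a) (vert (next a)) (vert c)) = true := by
  decide +kernel

theorem pos_spoke_check : ∀ (c : Fin 25) (t : Fin 27) (i : Fin 5) (β : Bool),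
    (c == nbr t i || bent (vert (nbr t i)) (tip t i β) (vert c)) = true := by
  decide +kernel

/-- The skeleton end of a link lies strictly beyond one of the two sides of the small pentagon that
meet at the corner where the link arrives. -/
theorem spoke_own_box_check : ∀ (t : Fin 27) (i : Fin 5),
    (ccw (tip t (i + 1) true) (tip t i true) (vert (nbr t i)) ||
      ccw (tip t i true) (tip t (i - 1) true) (vert (nbr t i))) = true := by
  decide +kernel

theorem straddle_check : ∀ (p : Fin 27 × Fin 5) (β β' : Bool),
    (partner p == p || straddles (vert (nbr p.1 p.2)) (tip p.1 p.2 β)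
      (vert (nbr (partner p).1 (partner p).2)) (tip (partner p).1 (partner p).2 β')) = true := by
  decide +kernel

/-- The vertices of the outermost cycle. -/
def corner (i : Fin 5) : Fin 25 := i.castLE (by omega)

/-- The outermost cycle is the small pentagon enlarged by 100, so `place` takes its corners exactly
to the ends of the links. -/
theorem vert_corner_check : ∀ i : Fin 5,
    vert (corner i) = (100 * (spike i).1, 100 * (spike i).2) := by
  decide +kernel

theorem vert_check : ∀ (a : Fin 25) (i : Fin 5),
    ccw (vert (corner (i + 1))) (vert (corner i)) (vert a) = false := by
  decide +kernel

theorem box_check : ∀ (t : Fin 27) (i : Fin 5) (β γ : Bool),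
    ccw (vert (corner (i + 1))) (vert (corner i))
      ((box t).1 + bif β then 38 else 0, (box t).2 + bif γ then 38 else 0) = false := by
  decide +kernel

theorem vert_injective : Function.Injective vert := by
  decide +kernel

theorem nbr_injective : ∀ t, Function.Injective (nbr t) := by
  decide +kernel

theorem next_ne : ∀ a, next a ≠ a := by
  decide +kernel

/-- For a crossing to be almost full, the skeleton ends of the two links must be joined by a cycle
edge, and the site of each must send an uncrossed link to the skeleton end of the other. -/
theorem partner_check : ∀ p : Fin 27 × Fin 5, (partner p == p ||
    (partner (partner p) == p && p.1 != (partner p).1 && (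
      next (nbr p.1 p.2) == nbr (partner p).1 (partner p).2 ||
      next (nbr (partner p).1 (partner p).2) == nbr p.1 p.2) &&
      (List.finRange 5).any fun j => nbr p.1 j == nbr (partner p).1 (partner p).2 &&
        partner (p.1, j) == (p.1, j))) = true := by
  decide +kernel

/-! ### Orientation, segments and boxes in the plane -/

/-- The oriented area of the parallelogram spanned by three points. -/
def det (a b c : ℝ × ℝ) : ℝ := (b.1 - a.1) * (c.2 - a.2) - (b.2 - a.2) * (c.1 - a.1)

/-- A point with natural coordinates as a point of the plane. -/
def toPlane (p : ℕ × ℕ) : ℝ × ℝ := (p.1, p.2)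

/-- The test `ccw` compares the positive with the negative terms of the determinant, which avoids
subtraction of natural numbers. -/
theorem det_pos_of_ccw {a b c : ℕ × ℕ} (h : ccw a b c = true) :
    0 < det (toPlane a) (toPlane b) (toPlane c) := by
  rw [ccw, Nat.blt_eq] at h
  have h' : ((a.2 * b.1 + b.2 * c.1 + c.2 * a.1 : ℕ) : ℝ) <
      ((a.1 * b.2 + b.1 * c.2 + c.1 * a.2 : ℕ) : ℝ) := by exact_mod_cast h
  push_cast at h'
  simp only [det, toPlane]
  linarith

theorem det_swap (a b c : ℝ × ℝ) : det b a c = -det a b c := by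
  simp only [det]
  ring

theorem det_nonneg_of_ccw {a b c : ℕ × ℕ} (h : ccw b a c = false) :
    0 ≤ det (toPlane a) (toPlane b) (toPlane c) := by
  have h1 := Bool.eq_false_iff.1 h
  rw [ccw, Ne, Nat.blt_eq, not_lt] at h1
  have h' : ((b.1 * a.2 + a.1 * c.2 + c.1 * b.2 : ℕ) : ℝ) ≤
      ((b.2 * a.1 + a.2 * c.1 + c.2 * b.1 : ℕ) : ℝ) := by exact_mod_cast h1
  push_cast at h'
  simp only [det, toPlane]
  linarith

theorem det_ne_zero_of_bent {a b c : ℕ × ℕ} (h : bent a b c = true) :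
    det (toPlane a) (toPlane b) (toPlane c) ≠ 0 := by
  rcases Bool.or_eq_true_iff.1 h with h | h
  · exact (det_pos_of_ccw h).ne'
  · have := det_pos_of_ccw h
    rw [det_swap] at this
    linarith

theorem exists_of_mem_segment {x y z : ℝ × ℝ} (hz : z ∈ segment ℝ x y) :
    ∃ s : ℝ, 0 ≤ s ∧ s ≤ 1 ∧ z = ((1 - s) * x.1 + s * y.1, (1 - s) * x.2 + s * y.2) := by
  obtain ⟨r, s, hr, hs, hrs, rfl⟩ := hz
  obtain rfl : r = 1 - s := by linarith
  exact ⟨s, hs, by linarith, by ext <;> simp⟩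

theorem det_eq_zero_of_mem_segment {a b z : ℝ × ℝ} (hz : z ∈ segment ℝ a b) : det a b z = 0 := by
  obtain ⟨s, -, -, rfl⟩ := exists_of_mem_segment hz
  simp only [det]
  ring

theorem det_pos_of_mem_segment {a b x y z : ℝ × ℝ} (hx : 0 < det a b x) (hy : 0 < det a b y)
    (hz : z ∈ segment ℝ x y) : 0 < det a b z := by
  obtain ⟨s, h0, h1, rfl⟩ := exists_of_mem_segment hz
  have h : det a b ((1 - s) * x.1 + s * y.1, (1 - s) * x.2 + s * y.2) =
      (1 - s) * det a b x + s * det a b y := by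
    simp only [det]
    ring
  rw [h]
  rcases h0.eq_or_lt with rfl | h0
  · simpa using hx
  · have : 0 ≤ (1 - s) * det a b x := mul_nonneg (by linarith) hx.le
    have := mul_pos h0 hy
    linarith

theorem disjoint_of_sameSide {a b c d : ℕ × ℕ} (h : sameSide a b c d = true) :
    Disjoint (segment ℝ (toPlane a) (toPlane b)) (segment ℝ (toPlane c) (toPlane d)) := by
  rw [Set.disjoint_left]
  intro z hz hz'
  simp only [sameSide, Bool.or_eq_true, Bool.and_eq_true] at h
  rcases h with ⟨h1, h2⟩ | ⟨h1, h2⟩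
  · exact (det_pos_of_mem_segment (det_pos_of_ccw h1) (det_pos_of_ccw h2) hz').ne'
      (det_eq_zero_of_mem_segment hz)
  · rw [segment_symm] at hz
    exact (det_pos_of_mem_segment (det_pos_of_ccw h1) (det_pos_of_ccw h2) hz').ne'
      (det_eq_zero_of_mem_segment hz)

theorem disjoint_of_apart {a b c d : ℕ × ℕ} (h : apart a b c d = true) :
    Disjoint (segment ℝ (toPlane a) (toPlane b)) (segment ℝ (toPlane c) (toPlane d)) := by
  rcases Bool.or_eq_true_iff.1 h with h | h
  · exact disjoint_of_sameSide h
  · exact (disjoint_of_sameSide h).symm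

theorem eq_of_mem_segment_of_det_ne_zero {a b c z : ℝ × ℝ} (h : det a b c ≠ 0)
    (hb : z ∈ segment ℝ a b) (hc : z ∈ segment ℝ a c) : z = a := by
  have h0 := det_eq_zero_of_mem_segment hb
  obtain ⟨s, -, -, rfl⟩ := exists_of_mem_segment hc
  have : s * det a b c = 0 := by
    rw [← h0]
    simp only [det]
    ring
  obtain rfl : s = 0 := (mul_eq_zero.1 this).resolve_right h
  ext <;> simp

theorem eq_of_bent {a b c : ℕ × ℕ} (h : bent a b c = true) {z : ℝ × ℝ}
    (hb : z ∈ segment ℝ (toPlane a) (toPlane b)) (hc : z ∈ segment ℝ (toPlane a) (toPlane c)) :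
    z = toPlane a :=
  eq_of_mem_segment_of_det_ne_zero (det_ne_zero_of_bent h) hb hc

theorem notMem_of_bent {a b c : ℕ × ℕ} (h : bent a b c = true) :
    toPlane c ∉ segment ℝ (toPlane a) (toPlane b) := fun hc =>
  det_ne_zero_of_bent h (det_eq_zero_of_mem_segment hc)

/-- The determinant is affine along the second segment with different values at its ends, so it
vanishes at most once, and it vanishes at every common point. -/
theorem subsingleton_of_straddles {a b c d : ℕ × ℕ} (h : straddles a b c d = true) :
    (segment ℝ (toPlane a) (toPlane b) ∩ segment ℝ (toPlane c) (toPlane d)).Subsingleton := by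
  have hne : det (toPlane a) (toPlane b) (toPlane c) ≠ det (toPlane a) (toPlane b) (toPlane d) := by
    simp only [straddles, Bool.or_eq_true, Bool.and_eq_true] at h
    rcases h with ⟨h1, h2⟩ | ⟨h1, h2⟩
    · have h1 := det_pos_of_ccw h1
      have h2 := det_pos_of_ccw h2
      rw [det_swap] at h2
      exact (by linarith : det (toPlane a) (toPlane b) (toPlane d) < _).ne'
    · have h1 := det_pos_of_ccw h1
      have h2 := det_pos_of_ccw h2
      rw [det_swap] at h1
      exact (by linarith : det (toPlane a) (toPlane b) (toPlane c) < _).ne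
  rintro z ⟨hz, hz'⟩ w ⟨hw, hw'⟩
  have h1 := det_eq_zero_of_mem_segment hz
  have h2 := det_eq_zero_of_mem_segment hw
  obtain ⟨s, -, -, rfl⟩ := exists_of_mem_segment hz'
  obtain ⟨r, -, -, rfl⟩ := exists_of_mem_segment hw'
  have key : (s - r) * (det (toPlane a) (toPlane b) (toPlane d) -
      det (toPlane a) (toPlane b) (toPlane c)) = 0 := by
    have h3 := h1.trans h2.symm
    simp only [det] at h3 ⊢
    linarith
  obtain rfl : s = r := by
    have := (mul_eq_zero.1 key).resolve_right (sub_ne_zero.2 hne.symm)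
    linarith
  rfl

/-- The box with the lower left corner `g`. -/
def boxSet (g : ℕ × ℕ) : Set (ℝ × ℝ) :=
  {z | g.1 ≤ z.1 ∧ z.1 ≤ g.1 + 38 ∧ g.2 ≤ z.2 ∧ z.2 ≤ g.2 + 38}

/-- An affine function on a box is minimal at a corner, which the signs of its two slopes select.
Thus statements about boxes need to be tested at four points only. -/
theorem exists_det_le {g : ℕ × ℕ} {z : ℝ × ℝ} (hz : z ∈ boxSet g) (a b : ℝ × ℝ) :
    ∃ β γ : Bool,
      det a b (toPlane (g.1 + bif β then 38 else 0, g.2 + bif γ then 38 else 0)) ≤ det a b z := by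
  obtain ⟨h1, h2, h3, h4⟩ := hz
  refine ⟨decide (0 ≤ b.2 - a.2), decide (b.1 - a.1 ≤ 0), ?_⟩
  by_cases hx : 0 ≤ b.2 - a.2 <;> by_cases hy : b.1 - a.1 ≤ 0 <;>
    simp only [hx, hy, decide_true, decide_false, cond_true, cond_false, det, toPlane] <;>
    push_cast
  · nlinarith [mul_nonneg hx (sub_nonneg.2 h2), mul_nonneg (neg_nonneg.2 hy) (sub_nonneg.2 h4)]
  · nlinarith [mul_nonneg hx (sub_nonneg.2 h2), mul_nonneg (not_le.1 hy).le (sub_nonneg.2 h3)]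
  · nlinarith [mul_nonneg (neg_nonneg.2 (not_le.1 hx).le) (sub_nonneg.2 h1),
      mul_nonneg (neg_nonneg.2 hy) (sub_nonneg.2 h4)]
  · nlinarith [mul_nonneg (neg_nonneg.2 (not_le.1 hx).le) (sub_nonneg.2 h1),
      mul_nonneg (not_le.1 hy).le (sub_nonneg.2 h3)]

theorem disjoint_boxSet_of_ccw {g a b : ℕ × ℕ}
    (h : (ccw a b g && ccw a b (g.1 + 38, g.2) && ccw a b (g.1, g.2 + 38) &&
      ccw a b (g.1 + 38, g.2 + 38)) = true) :
    Disjoint (segment ℝ (toPlane a) (toPlane b)) (boxSet g) := by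
  rw [Set.disjoint_left]
  intro z hz hzb
  simp only [Bool.and_eq_true] at h
  obtain ⟨⟨⟨h1, h2⟩, h3⟩, h4⟩ := h
  obtain ⟨β, γ, hle⟩ := exists_det_le hzb (toPlane a) (toPlane b)
  rw [det_eq_zero_of_mem_segment hz] at hle
  refine hle.not_gt (det_pos_of_ccw ?_)
  cases β <;> cases γ
  · exact h1
  · exact h3
  · exact h2
  · exact h4

theorem disjoint_of_outside {g a b : ℕ × ℕ} (h : outside g a b = true) :
    Disjoint (segment ℝ (toPlane a) (toPlane b)) (boxSet g) := by
  have hcoord : ∀ {x y s : ℝ} (m : ℝ), 0 ≤ s → s ≤ 1 → x < m → y < m →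
      (1 - s) * x + s * y < m := by
    intro x y s m h0 h1 hx hy
    nlinarith [mul_nonneg h0 (sub_nonneg.2 hy.le), mul_nonneg (sub_nonneg.2 h1)
      (sub_nonneg.2 hx.le)]
  unfold outside at h
  rw [Bool.or_eq_true, Bool.or_eq_true, Bool.or_eq_true, Bool.or_eq_true, Bool.or_eq_true] at h
  rcases h with ((((h | h) | h) | h) | h) | h
  · rw [Bool.and_eq_true, Nat.blt_eq, Nat.blt_eq] at h
    rw [Set.disjoint_left]
    rintro z hz ⟨h1, h2, h3, h4⟩
    obtain ⟨s, h0, h1', rfl⟩ := exists_of_mem_segment hz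
    have ha : (a.1 : ℝ) < g.1 := by exact_mod_cast h.1
    have hb : (b.1 : ℝ) < g.1 := by exact_mod_cast h.2
    exact h1.not_gt (hcoord _ h0 h1' ha hb)
  · rw [Bool.and_eq_true, Nat.blt_eq, Nat.blt_eq] at h
    rw [Set.disjoint_left]
    rintro z hz ⟨h1, h2, h3, h4⟩
    obtain ⟨s, h0, h1', rfl⟩ := exists_of_mem_segment hz
    have ha : (a.2 : ℝ) < g.2 := by exact_mod_cast h.1
    have hb : (b.2 : ℝ) < g.2 := by exact_mod_cast h.2
    exact h3.not_gt (hcoord _ h0 h1' ha hb)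
  · rw [Bool.and_eq_true, Nat.blt_eq, Nat.blt_eq] at h
    rw [Set.disjoint_left]
    rintro z hz ⟨h1, h2, h3, h4⟩
    obtain ⟨s, h0, h1', rfl⟩ := exists_of_mem_segment hz
    have ha : -(a.1 : ℝ) < -(g.1 + 38) := neg_lt_neg (by exact_mod_cast h.1)
    have hb : -(b.1 : ℝ) < -(g.1 + 38) := neg_lt_neg (by exact_mod_cast h.2)
    have := hcoord _ h0 h1' ha hb
    simp only [toPlane] at h2
    linarith
  · rw [Bool.and_eq_true, Nat.blt_eq, Nat.blt_eq] at h
    rw [Set.disjoint_left]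
    rintro z hz ⟨h1, h2, h3, h4⟩
    obtain ⟨s, h0, h1', rfl⟩ := exists_of_mem_segment hz
    have ha : -(a.2 : ℝ) < -(g.2 + 38) := neg_lt_neg (by exact_mod_cast h.1)
    have hb : -(b.2 : ℝ) < -(g.2 + 38) := neg_lt_neg (by exact_mod_cast h.2)
    have := hcoord _ h0 h1' ha hb
    simp only [toPlane] at h4
    linarith
  · exact disjoint_boxSet_of_ccw h
  · rw [segment_symm]
    exact disjoint_boxSet_of_ccw h

/-! ### The concrete frame has a layout -/

/-- Two vertices are adjacent if they are consecutive on one of the four cycles. -/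
def rim : SimpleGraph (Fin 25) where
  Adj a b := next a = b ∨ next b = a
  symm := ⟨fun _ _ h => h.symm⟩
  loopless := ⟨fun a h => next_ne a (or_self_iff.1 h)⟩

/-- The map of the plane onto itself that takes the square around the frame to the box of a
site. -/
noncomputable def place (t : Fin 27) : (ℝ × ℝ) →ᵃ[ℝ] (ℝ × ℝ) :=
  (1 / 100 : ℝ) • AffineMap.id ℝ (ℝ × ℝ) + AffineMap.const ℝ (ℝ × ℝ) (toPlane (box t))

theorem place_apply (t : Fin 27) (z : ℝ × ℝ) :
    place t z = (z.1 / 100 + (box t).1, z.2 / 100 + (box t).2) := by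
  ext <;> simp [place, toPlane] <;> ring

/-- Four nested cycles with 27 sites between them. -/
noncomputable def frame : Frame (Fin 25) (Fin 27) where
  graph := rim
  nb := nbr
  nb_injective := nbr_injective
  root := corner
  root_injective := Fin.castLE_injective (by omega)
  pos a := toPlane (vert a)
  place := place

/-- The pentagon bounded by the outermost cycle. -/
def pentagon : Set (ℝ × ℝ) :=
  {z | ∀ i : Fin 5, 0 ≤ det (toPlane (vert (corner i))) (toPlane (vert (corner (i + 1)))) z}

/-- The point that takes the place of a frame. -/
def centre : ℝ × ℝ := (1900, 1900)

/-- The edges with the numbers `p` and `q` may cross. -/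
def Partner (p q : Fin 27 × Fin 5) : Prop := partner p = q ∧ p ≠ q

theorem convex_pentagon : Convex ℝ pentagon := by
  intro x hx y hy r s hr hs hrs i
  obtain rfl : r = 1 - s := by linarith
  have h : det (toPlane (vert (corner i))) (toPlane (vert (corner (i + 1))))
      ((1 - s) • x + s • y) = (1 - s) * det (toPlane (vert (corner i)))
        (toPlane (vert (corner (i + 1)))) x +
      s * det (toPlane (vert (corner i))) (toPlane (vert (corner (i + 1)))) y := by
    simp only [det, Prod.fst_add, Prod.snd_add, Prod.smul_fst, Prod.smul_snd, smul_eq_mul]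
    ring
  rw [h]
  exact add_nonneg (mul_nonneg hr (hx i)) (mul_nonneg hs (hy i))

/-- Scaling by 1/100 takes the centre (1900, 1900) to the offset (19, 19) in the box, so both kinds
of ends have natural coordinates and can be checked by computation. -/
theorem port_eq (t : Fin 27) (i : Fin 5) (β : Bool) :
    frame.port centre t i β = toPlane (tip t i β) := by
  cases β with
  | false =>
    change place t centre = _
    simp only [place_apply, centre, tip, toPlane, cond_false]
    push_cast
    ext <;> ring
  | true =>
    change place t (toPlane (vert (corner i))) = _
    rw [vert_corner_check]
    simp only [place_apply, tip, toPlane, cond_true]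
    push_cast
    ext <;> ring

theorem spoke_eq (t : Fin 27) (i : Fin 5) (β : Bool) :
    frame.spoke centre t i β =
      segment ℝ (toPlane (vert (nbr t i))) (toPlane (tip t i β)) := by
  rw [Frame.spoke, port_eq]
  rfl

theorem mem_pentagon_iff {z : ℝ × ℝ} : z ∈ pentagon ↔
    0 ≤ det (1900, 3800) (100, 2500) z ∧ 0 ≤ det (100, 2500) (800, 400) z ∧
    0 ≤ det (800, 400) (3000, 400) z ∧ 0 ≤ det (3000, 400) (3700, 2500) z ∧
    0 ≤ det (3700, 2500) (1900, 3800) z := by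
  have h : ∀ i, toPlane (vert (corner i)) = ![(1900, 3800), (100, 2500), (800, 400), (3000, 400),
      (3700, 2500)] i := by
    intro i
    rw [vert_corner_check]
    fin_cases i <;> ext <;> norm_num [spike, toPlane]
  change (∀ i : Fin 5, 0 ≤ det (toPlane (vert (corner i))) (toPlane (vert (corner (i + 1)))) z) ↔ _
  simp only [h]
  constructor
  · exact fun hz => ⟨hz 0, hz 1, hz 2, hz 3, hz 4⟩
  · rintro ⟨h0, h1, h2, h3, h4⟩ i
    fin_cases i
    exacts [h0, h1, h2, h3, h4]

theorem pentagon_bounds {z : ℝ × ℝ} (hz : z ∈ pentagon) :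
    0 ≤ z.1 ∧ z.1 ≤ 3800 ∧ 0 ≤ z.2 ∧ z.2 ≤ 3800 := by
  obtain ⟨h0, h1, h2, h3, h4⟩ := mem_pentagon_iff.1 hz
  simp only [det] at h0 h1 h2 h3 h4
  refine ⟨?_, ?_, ?_, ?_⟩ <;> linarith

theorem patch_subset_boxSet (t : Fin 27) : frame.patch pentagon t ⊆ boxSet (box t) := by
  rintro _ ⟨z, hz, rfl⟩
  change place t z ∈ _
  rw [place_apply]
  obtain ⟨h1, h2, h3, h4⟩ := pentagon_bounds hz
  refine ⟨?_, ?_, ?_, ?_⟩ <;> simp only <;> linarith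

theorem boxSet_subset_pentagon (t : Fin 27) : boxSet (box t) ⊆ pentagon := by
  intro z hz i
  obtain ⟨β, γ, h⟩ := exists_det_le hz (toPlane (vert (corner i)))
    (toPlane (vert (corner (i + 1))))
  exact (det_nonneg_of_ccw (box_check t i β γ)).trans h

theorem toPlane_injective : Function.Injective toPlane := by
  rintro ⟨a, b⟩ ⟨c, d⟩ h
  simpa [toPlane] using h

theorem det_place (t : Fin 27) (a b c : ℝ × ℝ) :
    det (place t a) (place t b) (place t c) = det a b c / 10000 := by
  simp only [place_apply, det]
  ring

/-- Along the link, the determinant for a suitable side at the corner is negative at the skeleton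
end and zero at the corner. Points of the small pentagon have a nonnegative value, which leaves the
corner alone. -/
theorem spoke_own_box {t : Fin 27} {i : Fin 5} {z : ℝ × ℝ}
    (hz : z ∈ segment ℝ (toPlane (vert (nbr t i))) (toPlane (tip t i true)))
    (hz' : z ∈ frame.patch pentagon t) : z = toPlane (tip t i true) := by
  have htip : ∀ j, toPlane (tip t j true) = place t (toPlane (vert (corner j))) := fun j =>
    (port_eq t j true).symm
  have hside : ∀ j, 0 ≤ det (toPlane (tip t j true)) (toPlane (tip t (j + 1) true)) z := by
    obtain ⟨w, hw, rfl⟩ := hz'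
    intro j
    rw [htip, htip]
    change 0 ≤ det _ _ (place t w)
    rw [det_place]
    exact div_nonneg (hw j) (by norm_num)
  obtain ⟨s, -, h1, hzs⟩ := exists_of_mem_segment hz
  have key : ∀ a b : ℝ × ℝ, 0 ≤ det a b z → det a b (toPlane (tip t i true)) = 0 →
      det a b (toPlane (vert (nbr t i))) < 0 → z = toPlane (tip t i true) := by
    intro a b hab h0 hneg
    have : det a b z = (1 - s) * det a b (toPlane (vert (nbr t i))) +
        s * det a b (toPlane (tip t i true)) := by
      rw [hzs]
      simp only [det]
      ring
    rw [this, h0, mul_zero, add_zero] at hab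
    obtain rfl : s = 1 := by
      by_contra hs
      have : 0 < 1 - s := sub_pos.2 (lt_of_le_of_ne h1 hs)
      nlinarith
    rw [hzs]
    ext <;> simp
  rcases Bool.or_eq_true_iff.1 (spoke_own_box_check t i) with h | h
  · have h := det_pos_of_ccw h
    rw [det_swap] at h
    refine key _ _ (hside i) ?_ (by linarith)
    simp only [det]
    ring
  · have h := det_pos_of_ccw h
    rw [det_swap] at h
    have hi := hside (i - 1)
    rw [sub_add_cancel] at hi
    refine key _ _ hi ?_ (by linarith)
    simp only [det]
    ring

theorem mem_range_of_eq {z : ℝ × ℝ} {a : Fin 25} (h : z = toPlane (vert a)) :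
    z ∈ Set.range frame.pos := ⟨a, h.symm⟩

theorem rim_rim {a c : Fin 25} (hac : a ≠ c) {z : ℝ × ℝ}
    (hz : z ∈ segment ℝ (toPlane (vert a)) (toPlane (vert (next a))))
    (hz' : z ∈ segment ℝ (toPlane (vert c)) (toPlane (vert (next c)))) :
    z ∈ Set.range frame.pos := by
  have h := rim_rim_check a c hac
  simp only [Bool.or_eq_true, Bool.and_eq_true, beq_iff_eq] at h
  rcases h with (h | ⟨h1, h2⟩) | ⟨h1, h2⟩
  · exact (Set.disjoint_left.1 (disjoint_of_apart h) hz hz').elim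
  · rw [h1, segment_symm] at hz
    exact mem_range_of_eq (eq_of_bent h2 hz hz')
  · rw [h1, segment_symm] at hz'
    exact mem_range_of_eq (eq_of_bent h2 hz' hz)

theorem rim_spoke (a : Fin 25) (t : Fin 27) (i : Fin 5) (β : Bool) {z : ℝ × ℝ}
    (hz : z ∈ segment ℝ (toPlane (vert a)) (toPlane (vert (next a))))
    (hz' : z ∈ segment ℝ (toPlane (vert (nbr t i))) (toPlane (tip t i β))) :
    z ∈ Set.range frame.pos := by
  have h := rim_spoke_check a t i β
  simp only [Bool.or_eq_true, Bool.and_eq_true, beq_iff_eq] at h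
  rcases h with (h | ⟨h1, h2⟩) | ⟨h1, h2⟩
  · exact (Set.disjoint_left.1 (disjoint_of_apart h) hz hz').elim
  · rw [h1] at hz'
    exact mem_range_of_eq (eq_of_bent h2 hz hz')
  · rw [h1] at hz'
    rw [segment_symm] at hz
    exact mem_range_of_eq (eq_of_bent h2 hz hz')

theorem partner_spec {p q : Fin 27 × Fin 5} (h : Partner p q) :
    partner q = p ∧ p.1 ≠ q.1 ∧
      (next (nbr p.1 p.2) = nbr q.1 q.2 ∨ next (nbr q.1 q.2) = nbr p.1 p.2) ∧
      ∃ j, nbr p.1 j = nbr q.1 q.2 ∧ partner (p.1, j) = (p.1, j) := by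
  obtain ⟨rfl, hne⟩ := h
  have h := partner_check p
  simp only [Bool.or_eq_true, Bool.and_eq_true, beq_iff_eq, bne_iff_ne, List.any_eq_true] at h
  rcases h with h | ⟨⟨⟨h1, h2⟩, h3⟩, j, -, h4⟩
  · exact (hne h.symm).elim
  · exact ⟨h1, h2, h3, j, h4⟩

theorem partner_symm {p q : Fin 27 × Fin 5} (h : Partner p q) : Partner q p :=
  ⟨(partner_spec h).1, h.2.symm⟩

theorem spoke_spoke {t t' : Fin 27} (htt : t < t') (i j : Fin 5) (β β' : Bool)
    (hp : ¬ Partner (t, i) (t', j)) {z : ℝ × ℝ}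
    (hz : z ∈ segment ℝ (toPlane (vert (nbr t i))) (toPlane (tip t i β)))
    (hz' : z ∈ segment ℝ (toPlane (vert (nbr t' j))) (toPlane (tip t' j β'))) :
    z ∈ Set.range frame.pos := by
  have h := spoke_spoke_check t t' htt i j β β'
  simp only [Bool.or_eq_true, Bool.and_eq_true, beq_iff_eq] at h
  rcases h with (h | ⟨h1, h2⟩) | h
  · exact (Set.disjoint_left.1 (disjoint_of_apart h) hz hz').elim
  · rw [← h1] at hz'
    exact mem_range_of_eq (eq_of_bent h2 hz hz')
  · exact (hp ⟨h, fun heq => htt.ne (congrArg Prod.fst heq)⟩).elim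

theorem exists_next_of_adj {a b : Fin 25} (h : rim.Adj a b) :
    ∃ c, s(a, b) = s(c, next c) ∧ segment ℝ (toPlane (vert a)) (toPlane (vert b)) =
      segment ℝ (toPlane (vert c)) (toPlane (vert (next c))) := by
  rcases h with rfl | rfl
  · exact ⟨a, rfl, rfl⟩
  · exact ⟨b, Sym2.eq_swap, segment_symm ℝ _ _⟩

theorem layout : frame.Layout pentagon centre Partner where
  convex := convex_pentagon
  mem := by
    rw [mem_pentagon_iff]
    norm_num [centre, det]
  place_injective t := by
    intro x y h
    have h : place t x = place t y := h
    simp only [place_apply, Prod.mk.injEq, add_left_inj] at h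
    ext
    · linarith [h.1]
    · linarith [h.2]
  pos_injective := toPlane_injective.comp vert_injective
  pos_mem a i := det_nonneg_of_ccw (vert_check a i)
  patch_subset t := (patch_subset_boxSet t).trans (boxSet_subset_pentagon t)
  rim_rim := by
    rintro a b c d hab hcd hne z ⟨hz, hz'⟩
    obtain ⟨a', ha, ha'⟩ := exists_next_of_adj hab
    obtain ⟨c', hc, hc'⟩ := exists_next_of_adj hcd
    rw [ha, hc] at hne
    refine rim_rim (a := a') (c := c') (fun h => hne (by rw [h])) ?_ ?_
    · rw [← ha']
      exact hz
    · rw [← hc']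
      exact hz'
  rim_spoke := by
    rintro a b t i β hab z ⟨hz, hz'⟩
    obtain ⟨a', -, ha'⟩ := exists_next_of_adj hab
    rw [spoke_eq] at hz'
    exact rim_spoke a' t i β (ha' ▸ hz) hz'
  spoke_spoke := by
    rintro t t' i j β β' hne hp z ⟨hz, hz'⟩
    rw [spoke_eq] at hz hz'
    rcases lt_or_gt_of_ne hne with h | h
    · exact spoke_spoke h i j β β' hp hz hz'
    · exact spoke_spoke h j i β' β (fun h => hp (partner_symm h)) hz' hz
  spoke_own := by
    rintro t i j β hij z ⟨hz, hz'⟩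
    rw [spoke_eq] at hz hz'
    rw [port_eq]
    obtain ⟨h1, h2⟩ := Bool.and_eq_true_iff.1 (spoke_own_check t i j hij)
    cases β with
    | false =>
      rw [segment_symm] at hz hz'
      exact eq_of_bent h1 hz hz'
    | true => exact (Set.disjoint_left.1 (disjoint_of_apart h2) hz hz').elim
  once := by
    rintro t t' i j β β' ⟨h, hne⟩
    rw [spoke_eq, spoke_eq]
    have hs := straddle_check (t, i) β β'
    rw [h] at hs
    simp only [Bool.or_eq_true, beq_iff_eq] at hs
    exact subsingleton_of_straddles (hs.resolve_left fun h => hne h.symm)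
  rim_patch := by
    intro a b t hab
    obtain ⟨a', -, ha'⟩ := exists_next_of_adj hab
    change Disjoint (segment ℝ (toPlane (vert a)) (toPlane (vert b))) _
    rw [ha']
    exact (disjoint_of_outside (rim_box_check a' t)).mono_right (patch_subset_boxSet t)
  patch_patch := by
    intro t t' hne
    refine Disjoint.mono (patch_subset_boxSet t) (patch_subset_boxSet t') ?_
    rw [Set.disjoint_left]
    rintro z ⟨h1, h2, h3, h4⟩ ⟨h1', h2', h3', h4'⟩
    have h := box_box_check t t' hne
    simp only [Bool.or_eq_true, Nat.blt_eq] at h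
    rcases h with ((h | h) | h) | h
    all_goals
      rw [← Nat.cast_lt (α := ℝ)] at h
      push_cast at h
      linarith
  spoke_patch := by
    intro t t' i β hne
    rw [spoke_eq]
    exact (disjoint_of_outside (spoke_box_check t t' i β hne)).mono_right (patch_subset_boxSet t')
  spoke_own_patch := by
    rintro t i z ⟨hz, hz'⟩
    rw [spoke_eq] at hz
    rw [port_eq]
    exact spoke_own_box hz hz'
  pos_patch := by
    intro a t h
    exact Set.disjoint_left.1 (disjoint_of_outside (rim_box_check a t))
      (left_mem_segment ℝ _ _) (patch_subset_boxSet t h)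
  pos_rim := by
    intro a b c hab hc
    obtain ⟨a', ha, ha'⟩ := exists_next_of_adj hab
    have hc' : toPlane (vert c) ∈ segment ℝ (toPlane (vert a')) (toPlane (vert (next a'))) :=
      ha' ▸ hc
    have h := pos_rim_check a' c
    simp only [Bool.or_eq_true, beq_iff_eq] at h
    rw [← Sym2.mem_iff, ha, Sym2.mem_iff]
    exact h.resolve_right fun h => notMem_of_bent h hc'
  pos_spoke := by
    intro c t i β hc
    rw [spoke_eq] at hc
    have h := pos_spoke_check c t i β
    simp only [Bool.or_eq_true, beq_iff_eq] at h
    exact h.resolve_right fun h => notMem_of_bent h hc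
  part_symm _ _ := partner_symm
  part_unique _ _ _ h h' := h.1.symm.trans h'.1
  part_ne _ _ h := (partner_spec h).2.1
  part_adj _ _ h := (partner_spec h).2.2.1
  part_side := by
    intro p q h
    obtain ⟨j, h1, h2⟩ := (partner_spec h).2.2.2
    exact ⟨j, h1, fun r hr => hr.2 (h2.symm.trans hr.1)⟩

end Nest

/-! ### The core cannot be split by four vertices -/

theorem AvoidReach.of_isChain {V : Type*} {G : SimpleGraph V} {F : Finset V} :
    ∀ {u : V} {l : List V}, List.IsChain G.Adj (u :: l) → (∀ x ∈ l, x ∉ F) →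
      ∀ w ∈ (u :: l).getLast?, AvoidReach G F u w
  | u, [], _, _, w, hw => by
    obtain rfl : u = w := by simpa using hw
    exact .refl
  | u, v :: l, h, hl, w, hw => by
    rw [List.isChain_cons_cons] at h
    have hw' : w ∈ (v :: l).getLast? := by simpa using hw
    exact Relation.ReflTransGen.head ⟨h.1, hl v (by simp)⟩
      (of_isChain h.2 (fun x hx => hl x (by simp [hx])) w hw')

/-- More disjoint lists than the elements of `F` cannot all meet `F`. -/
theorem exists_list_avoiding {V : Type*} [DecidableEq V] {F : Finset V} {ps : List (List V)}
    (h : ps.flatten.Nodup) (hF : F.card < ps.length) : ∃ l ∈ ps, ∀ x ∈ l, x ∉ F := by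
  by_contra! hall
  have key : ∀ qs : List (List V), (∀ l ∈ qs, ∃ x ∈ l, x ∈ F) →
      qs.length ≤ (qs.flatten.filter (· ∈ F)).length := by
    intro qs
    induction qs with
    | nil => simp
    | cons l qs ih =>
      intro hq
      obtain ⟨x, hx, hxF⟩ := hq l (by simp)
      have h1 : 0 < (l.filter (· ∈ F)).length :=
        List.length_pos_of_mem (List.mem_filter.2 ⟨hx, by simpa using hxF⟩)
      have h2 := ih fun l' hl' => hq l' (by simp [hl'])
      simp only [List.flatten_cons, List.filter_append, List.length_append, List.length_cons]
      omega
  have h1 := key ps hall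
  rw [← List.toFinset_card_of_nodup (h.filter _)] at h1
  have h2 : (ps.flatten.filter (· ∈ F)).toFinset ⊆ F := by
    intro x hx
    simpa using (List.mem_filter.1 (List.mem_toFinset.1 hx)).2
  have := Finset.card_le_card h2
  omega

namespace Nest

/-- The vertex or site with a given number. -/
def code (n : ℕ) : Fin 25 ⊕ Fin 27 :=
  if n < 25 then .inl (Fin.ofNat 25 n) else .inr (Fin.ofNat 27 (n - 25))

/-- A test for adjacency in the core of the frame. -/
def joined : Fin 25 ⊕ Fin 27 → Fin 25 ⊕ Fin 27 → Bool
  | .inl a, .inl b => next a == b || next b == a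
  | .inl a, .inr t => (List.finRange 5).any fun i => nbr t i == a
  | .inr t, .inl a => (List.finRange 5).any fun i => nbr t i == a
  | .inr _, .inr _ => false

theorem adj_of_joined {x y : Fin 25 ⊕ Fin 27} (h : joined x y = true) : frame.core.Adj x y := by
  rcases x with a | t <;> rcases y with b | t'
  · simp only [joined, Bool.or_eq_true, beq_iff_eq] at h
    exact h
  · simp only [joined, List.any_eq_true, beq_iff_eq] at h
    obtain ⟨i, -, hi⟩ := h
    exact ⟨i, hi⟩
  · simp only [joined, List.any_eq_true, beq_iff_eq] at h
    obtain ⟨i, -, hi⟩ := h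
    exact ⟨i, hi⟩
  · simp [joined] at h

/-- The paths are disjoint, there are five, and they start at `x`. -/
def isBundle (x : Fin 25 ⊕ Fin 27) (ps : List (List (Fin 25 ⊕ Fin 27))) : Bool :=
  ps.length == 5 && decide ps.flatten.Nodup &&
    ps.all fun l => decide (List.IsChain (fun x y => joined x y = true) (x :: l))

theorem exists_path_of_isBundle {x : Fin 25 ⊕ Fin 27} {ps : List (List (Fin 25 ⊕ Fin 27))}
    (h : isBundle x ps = true) {F : Finset (Fin 25 ⊕ Fin 27)} (hF : F.card ≤ 4) :
    ∃ l ∈ ps, (∀ y ∈ l, y ∉ F) ∧ List.IsChain frame.core.Adj (x :: l) := by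
  simp only [isBundle, Bool.and_eq_true, beq_iff_eq, decide_eq_true_eq, List.all_eq_true] at h
  obtain ⟨⟨h1, h2⟩, h3⟩ := h
  obtain ⟨l, hl, hlF⟩ := exists_list_avoiding h2 (by omega : F.card < ps.length)
  exact ⟨l, hl, hlF, (h3 l hl).imp fun _ _ => adj_of_joined⟩

/-- Five disjoint paths between any two non-adjacent vertices of the outermost cycle: four deletions
leave one of them intact. -/
theorem ladder_check : ∀ a b : Fin 5, a < b → (joined (.inl (corner a)) (.inl (corner b)) ||
    ladder.any fun e => e.1 == (corner a, corner b) &&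
      isBundle (.inl (corner a)) (e.2.map (List.map code)) &&
      (e.2.map (List.map code)).all fun l =>
        (((.inl (corner a) :: l).getLast?).any fun y => joined y (.inl (corner b)))) = true := by
  decide +kernel

/-- The five paths end in distinct vertices with smaller numbers, and these ends belong to the
disjoint lists. One path therefore survives four deletions together with its end; its inner vertices
may have larger numbers. -/
theorem fan_check : ∀ a : Fin 25, 5 ≤ a.val →
    (isBundle (.inl a) ((fan a).map (List.map code)) &&
      ((fan a).map (List.map code)).all fun l => (List.finRange 25).any fun b =>
        decide (b < a) && decide ((.inl a :: l).getLast? = some (.inl b))) = true := by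
  decide +kernel

variable {F : Finset (Fin 25 ⊕ Fin 27)}

theorem avoidReach_corner (hF : F.card ≤ 4) {a b : Fin 5} (hab : a < b)
    (hb : (.inl (corner b) : Fin 25 ⊕ Fin 27) ∉ F) :
    AvoidReach frame.core F (.inl (corner a)) (.inl (corner b)) := by
  have h := ladder_check a b hab
  rw [Bool.or_eq_true, List.any_eq_true] at h
  rcases h with h | ⟨e, -, h⟩
  · exact Relation.ReflTransGen.single ⟨adj_of_joined h, hb⟩
  · rw [Bool.and_eq_true, Bool.and_eq_true, List.all_eq_true] at h
    obtain ⟨⟨-, h2⟩, h3⟩ := h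
    obtain ⟨l, hl, hlF, hchain⟩ := exists_path_of_isBundle h2 hF
    have h4 := h3 l hl
    rw [Option.any_eq_true] at h4
    obtain ⟨y, hy, hyb⟩ := h4
    exact (AvoidReach.of_isChain hchain hlF y hy).tail ⟨adj_of_joined hyb, hb⟩

/-- Surviving fan paths lead to smaller and smaller numbers until the outermost cycle is reached,
where the ladders connect everything. -/
theorem avoidReach_inl (hF : F.card ≤ 4) (n : ℕ) : ∀ a b : Fin 25, a.val < 5 + n →
    b.val < 5 + n → (.inl a : Fin 25 ⊕ Fin 27) ∉ F → (.inl b : Fin 25 ⊕ Fin 27) ∉ F →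
    AvoidReach frame.core F (.inl a) (.inl b) := by
  induction n with
  | zero =>
    intro a b ha hb haF hbF
    obtain ⟨i, rfl⟩ : ∃ i, corner i = a := ⟨⟨a, ha⟩, rfl⟩
    obtain ⟨j, rfl⟩ : ∃ j, corner j = b := ⟨⟨b, hb⟩, rfl⟩
    rcases lt_trichotomy i j with h | rfl | h
    · exact avoidReach_corner hF h hbF
    · exact .refl
    · exact (avoidReach_corner hF h haF).symm hbF
  | succ n ih =>
    have hdown : ∀ a : Fin 25, a.val < 5 + (n + 1) → (.inl a : Fin 25 ⊕ Fin 27) ∉ F →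
        ∃ b : Fin 25, b.val < 5 + n ∧ (.inl b : Fin 25 ⊕ Fin 27) ∉ F ∧
          AvoidReach frame.core F (.inl a) (.inl b) := by
      intro a ha haF
      by_cases han : a.val < 5 + n
      · exact ⟨a, han, haF, .refl⟩
      · have h := fan_check a (by omega)
        rw [Bool.and_eq_true, List.all_eq_true] at h
        obtain ⟨l, hl, hlF, hchain⟩ := exists_path_of_isBundle h.1 hF
        have h' := h.2 l hl
        simp only [List.any_eq_true, Bool.and_eq_true, decide_eq_true_eq] at h'
        obtain ⟨b, -, hba, hb⟩ := h'
        refine ⟨b, by omega, ?_, AvoidReach.of_isChain hchain hlF _ hb⟩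
        have hmem : (.inl b : Fin 25 ⊕ Fin 27) ∈ (.inl a :: l : List (Fin 25 ⊕ Fin 27)) :=
          List.mem_of_getLast? hb
        rcases List.mem_cons.1 hmem with h | h
        · exact (hba.ne (Sum.inl_injective h)).elim
        · exact hlF _ h
    intro a b ha hb haF hbF
    obtain ⟨a', ha', haF', haa⟩ := hdown a ha haF
    obtain ⟨b', hb', hbF', hbb⟩ := hdown b hb hbF
    exact (haa.trans (ih a' b' ha' hb' haF' hbF')).trans (hbb.symm hbF)

/-- A surviving site has five distinct skeleton neighbours, so one of them survives and reduces the
claim to skeleton vertices. -/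
theorem unsplittable_core : Unsplittable frame.core := by
  intro F hF
  have hdown : ∀ x : Fin 25 ⊕ Fin 27, x ∉ F → ∃ b : Fin 25, (.inl b : Fin 25 ⊕ Fin 27) ∉ F ∧
      AvoidReach frame.core F x (.inl b) := by
    rintro (a | t) hx
    · exact ⟨a, hx, .refl⟩
    · by_contra! hall
      have hsub : Finset.univ.image (fun i => (.inl (nbr t i) : Fin 25 ⊕ Fin 27)) ⊆ F := by
        intro y hy
        obtain ⟨i, -, rfl⟩ := Finset.mem_image.1 hy
        by_contra hi
        exact hall _ hi (Relation.ReflTransGen.single ⟨⟨i, rfl⟩, hi⟩)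
      have := Finset.card_le_card hsub
      rw [Finset.card_image_of_injective _ fun i j h => nbr_injective t (Sum.inl_injective h),
        Finset.card_univ, Fintype.card_fin] at this
      omega
  intro u v hu hv
  obtain ⟨a, ha, hua⟩ := hdown u hu
  obtain ⟨b, hb, hvb⟩ := hdown v hv
  -- All 25 skeleton vertices have numbers below 5 + 20.
  exact (hua.trans (avoidReach_inl hF 20 a b (by omega) (by omega) ha hb)).trans (hvb.symm hv)

end Nest

/-! ### Transport of drawings along isomorphisms -/

namespace Drawing

variable {V W : Type*} {G : SimpleGraph V}

theorem mem_edgeSet_comap (e : W ≃ V) (f : Sym2 W) :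
    f ∈ (G.comap e).edgeSet ↔ f.map e ∈ G.edgeSet := by
  induction f using Sym2.ind with
  | _ x y => exact Iff.rfl

theorem map_mem_map_iff (e : W ≃ V) {w : W} {f : Sym2 W} : e w ∈ f.map e ↔ w ∈ f := by
  simp [Sym2.mem_map]

/-- A drawing of an isomorphic graph. -/
def comap (D : Drawing G) (e : W ≃ V) : Drawing (G.comap e) where
  pos w := D.pos (e w)
  pos_injective := D.pos_injective.comp e.injective
  arc f := D.arc (f.map e)
  arc_isArc u v h := D.arc_isArc (e u) (e v) h
  arc_vertex f hf w hw := (map_mem_map_iff e).1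
    (D.arc_vertex _ ((mem_edgeSet_comap e f).1 hf) (e w) hw)
  cross_disjoint f hf g hg hne hz w hw hw' := by
    refine D.cross_disjoint _ ((mem_edgeSet_comap e f).1 hf) _ ((mem_edgeSet_comap e g).1 hg)
      (fun h => hne (Sym2.map.injective e.injective h)) ?_ (e w) ((map_mem_map_iff e).2 hw)
      ((map_mem_map_iff e).2 hw')
    rwa [← e.surjective.range_comp]
  cross_once f hf g hg hne := by
    have := D.cross_once _ ((mem_edgeSet_comap e f).1 hf) _ ((mem_edgeSet_comap e g).1 hg)
      (fun h => hne (Sym2.map.injective e.injective h))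
    rwa [← e.surjective.range_comp] at this

theorem Crosses.map {D : Drawing G} {e : W ≃ V} {f g : Sym2 W} (h : (D.comap e).Crosses f g) :
    D.Crosses (f.map e) (g.map e) := by
  obtain ⟨hf, hg, hne, hz⟩ := h
  refine ⟨(mem_edgeSet_comap e f).1 hf, (mem_edgeSet_comap e g).1 hg,
    fun h => hne (Sym2.map.injective e.injective h), ?_⟩
  rw [← e.surjective.range_comp]
  exact hz

theorem IsOnePlanar.comap {D : Drawing G} (h : D.IsOnePlanar) (e : W ≃ V) :
    (D.comap e).IsOnePlanar := fun _ _ _ h1 h2 =>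
  Sym2.map.injective e.injective (h _ _ _ h1.map h2.map)

end Drawing

theorem AlmostFullPair.comap {V W : Type*} {G : SimpleGraph V} (e : W ≃ V) {f g : Sym2 W}
    (h : AlmostFullPair G (f.map e) (g.map e)) : AlmostFullPair (G.comap e) f g := by
  obtain ⟨ψ⟩ := h
  refine ⟨RelIso.trans ⟨e.subtypeEquiv fun w => ?_, Iff.rfl⟩ ψ⟩
  change w ∈ f ∨ w ∈ g ↔ e w ∈ f.map e ∨ e w ∈ g.map e
  rw [Drawing.map_mem_map_iff, Drawing.map_mem_map_iff]

namespace Gadget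

/-- The graph of a gadget, with vertices renamed. -/
noncomputable def toFin (H : Gadget) : FinGraph :=
  ⟨Fintype.card H.V, H.graph.comap (Fintype.equivFin H.V).symm⟩

theorem Straight.onePlanar_toFin {H : Gadget} (h : H.Straight) : OnePlanar H.toFin.2 :=
  ⟨h.drawing.comap _, Drawing.IsOnePlanar.comap (D := h.drawing) h.onePlanar _⟩

theorem Straight.weaklyLocallyMaximal_toFin {H : Gadget} (h : H.Straight)
    (hmax : H.LocallyMaximal) : WeaklyLocallyMaximalOnePlanar H.toFin.2 := by
  refine ⟨h.drawing.comap _, Drawing.IsOnePlanar.comap (D := h.drawing) h.onePlanar _, ?_, ?_⟩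
  · intro e f hef u hu x hx g hg
    exact (hmax _ _ hef.map).2 _ ((Drawing.map_mem_map_iff _).2 hu) _
      ((Drawing.map_mem_map_iff _).2 hx) _ hg.map
  · intro e f hef
    exact .inr ((hmax _ _ hef.map).1.comap _)

end Gadget

/-! ### Towers: iterated insertion and growth rates -/

namespace Nest

/-- Iterated insertion of the frame into itself at the sites in `P`. -/
noncomputable def tower (P : Fin 27 → Bool) : ℕ → Gadget
  | 0 => .point centre
  | k + 1 => frame.plug fun t => bif P t then tower P k else .point centre

variable {P : Fin 27 → Bool}

/-- A property of gadgets that holds for a point and is preserved by insertion into the frame holds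
for every tower. -/
theorem tower_induction {C : Gadget → Prop} (hpoint : C (.point centre))
    (hplug : ∀ H : Fin 27 → Gadget, (∀ t, C (H t)) → C (frame.plug H)) (k : ℕ) :
    C (tower P k) := by
  induction k with
  | zero => exact hpoint
  | succ k ih =>
    refine hplug _ fun t => ?_
    cases P t
    · exact hpoint
    · exact ih

theorem robust_tower (k : ℕ) : (tower P k).Robust :=
  tower_induction (Gadget.robust_point _) (fun _ => Frame.robust_plug unsplittable_core) k

theorem fits_tower (k : ℕ) :
    (tower P k).Fits pentagon centre fun i => frame.pos (frame.root i) :=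
  tower_induction (C := fun H => H.Fits pentagon centre fun i => frame.pos (frame.root i))
    (Gadget.fits_point layout.mem) (fun _ => layout.fits_plug) k

theorem card_plug (H : Fin 27 → Gadget) :
    Fintype.card (frame.plug H).V = 25 + ∑ t, Fintype.card (H t).V := by
  have h : Fintype.card (frame.plug H).V = Fintype.card (Fin 25 ⊕ Σ t, (H t).V) :=
    Fintype.card_congr (Equiv.refl _)
  rw [h, Fintype.card_sum, Fintype.card_sigma, Fintype.card_fin]

theorem card_tower_pos (k : ℕ) : 0 < Fintype.card (tower P k).V :=
  tower_induction (C := fun H => 0 < Fintype.card H.V) (Fintype.card_pos_iff.2 ⟨()⟩)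
    (fun H _ => by rw [card_plug]; omega) k

theorem card_tower_succ_gt (k : ℕ) : 5 < Fintype.card (tower P (k + 1)).V := by
  rw [tower, card_plug]
  omega

theorem kConnected_tower (k : ℕ) : KConnected 5 (tower P (k + 1)).toFin.2 :=
  ((robust_tower (k + 1)).1.comap _).kConnected (by
    rw [Fintype.card_fin]
    exact card_tower_succ_gt k)

/-- Sites with a crossed link have to keep single vertices, so insertion is restricted to sites
without crossed links. -/
theorem locallyMaximal_tower (hP : ∀ t i q, Partner (t, i) q → P t = false) (k : ℕ) :
    (tower P k).LocallyMaximal := by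
  induction k with
  | zero => exact Gadget.locallyMaximal_point _
  | succ k ih =>
    refine layout.locallyMaximal_plug (fun t => ?_) (fun t => ?_) fun t i q h => ?_
    · cases P t
      · exact fits_tower (P := P) 0
      · exact fits_tower k
    · cases P t
      · exact Gadget.locallyMaximal_point _
      · exact ih
    · rw [hP t i q h]
      exact inferInstanceAs (Subsingleton Unit)

theorem not_traceable_tower (k : ℕ) : ¬ Traceable (tower P (k + 1)).toFin.2 := by
  refine Frame.not_traceable_plug (by simp) (fun t => ?_) _
  cases P t
  · exact ⟨()⟩
  · exact Fintype.card_pos_iff.1 (card_tower_pos k)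

/-- The slack 2 absorbs the additive 25 of the recursion: 25 + 25 (3 · 25 ^ k - 2) + 2 is at most 3
· 25 ^ (k + 1). -/
theorem cycleBound_tower (k : ℕ) : ∃ b, b + 2 ≤ 3 * 25 ^ k ∧ (tower P k).CycleBound b := by
  induction k with
  | zero => exact ⟨1, by norm_num, Gadget.cycleBound_point _⟩
  | succ k ih =>
    obtain ⟨b, hb, hbound⟩ := ih
    -- The maximum with 1 accounts for the sites that hold a single vertex.
    refine ⟨25 + 25 * max b 1, ?_, ?_⟩
    · have : 0 < 25 ^ k := by positivity
      rw [pow_succ]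
      omega
    · have := Frame.cycleBound_plug (B := frame) (b := max b 1)
        (H := fun t => bif P t then tower P k else .point centre) fun t => ?_
      · simpa [tower] using this
      · cases P t
        · intro W _ G ι h1 h2 h3 w p hp
          exact (Gadget.cycleBound_point centre W G ι h1 h2 h3 w p hp).trans (le_max_right _ _)
        · intro W _ G ι h1 h2 h3 w p hp
          exact (hbound W G ι h1 h2 h3 w p hp).trans (le_max_left _ _)

theorem circ_tower_le (k : ℕ) : circ (tower P k).toFin.2 ≤ 3 * 25 ^ k := by
  obtain ⟨b, hb, hbound⟩ := cycleBound_tower (P := P) k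
  exact (hbound.circ_le _).trans (by omega)

theorem pow_le_card_tower (k : ℕ) : 27 ^ k ≤ Fintype.card (tower (fun _ => true) k).V := by
  induction k with
  | zero => exact card_tower_pos 0
  | succ k ih =>
    rw [tower, card_plug]
    simp only [cond_true, Finset.sum_const, Finset.card_univ, Fintype.card_fin, smul_eq_mul]
    rw [pow_succ]
    omega

theorem card_tower_strictMono {t : Fin 27} (ht : P t = true) :
    StrictMono fun k => Fintype.card (tower P k).V := by
  refine strictMono_nat_of_lt_succ fun k => ?_
  rw [tower, card_plug]
  have := Finset.single_le_sum (f := fun t => Fintype.card (bif P t then tower P k else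
    Gadget.point centre).V) (fun _ _ => Nat.zero_le _) (Finset.mem_univ t)
  simp only [ht, cond_true] at this
  omega

/-- No edge at the innermost site is crossed. -/
theorem innermost_check : ∀ (t : Fin 27) (i : Fin 5), partner (t, i) ≠ (t, i) → t ≠ 26 := by
  decide +kernel

/-- The fraction 49/50 separates log 25 / log 27 from log 20 / log 21, and the gap on the left
absorbs the constant factor 3 once `k` is at least 200. -/
theorem log_le_of_large {k n c : ℕ} (hk : 200 ≤ k) (hn : 27 ^ k ≤ n) (hc : c ≤ 3 * 25 ^ k) :
    Real.log c / Real.log n ≤ Real.log 20 / Real.log 21 := by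
  have h25 : 0 < Real.log 25 := Real.log_pos (by norm_num)
  have h27 : 0 < Real.log 27 := Real.log_pos (by norm_num)
  have h21 : 0 < Real.log 21 := Real.log_pos (by norm_num)
  have hk' : (200 : ℝ) ≤ k := by exact_mod_cast hk
  have hlogn : k * Real.log 27 ≤ Real.log n := by
    rw [← Real.log_pow]
    exact Real.log_le_log (by positivity) (by exact_mod_cast hn)
  have hlogc : Real.log c ≤ Real.log 3 + k * Real.log 25 := by
    rw [← Real.log_pow, ← Real.log_mul (by norm_num) (by positivity)]
    -- For `c = 0` the default value `Real.log 0 = 0` keeps the bound valid.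
    rcases Nat.eq_zero_or_pos c with rfl | hc0
    · simp only [Nat.cast_zero, Real.log_zero]
      refine Real.log_nonneg ?_
      have : (1 : ℝ) ≤ 25 ^ k := one_le_pow₀ (by norm_num)
      linarith
    · exact Real.log_le_log (by exact_mod_cast hc0) (by exact_mod_cast hc)
  have hpos : 0 < k * Real.log 27 := by positivity
  rw [div_le_div_iff₀ (hpos.trans_le hlogn) h21]
  have h1 : 49 * Real.log 21 ≤ 50 * Real.log 20 := by
    have := Real.log_le_log (by positivity) (by norm_num : (21 : ℝ) ^ 49 ≤ 20 ^ 50)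
    rw [Real.log_pow, Real.log_pow] at this
    exact_mod_cast this
  have h2 : Real.log 3 + k * Real.log 25 ≤ 49 / 50 * (k * Real.log 27) := by
    -- As log 3 is a third of log 27, the estimate needs 43/44 + 1/600 ≤ 49/50.
    have h3 : 44 * Real.log 25 ≤ 43 * Real.log 27 := by
      have := Real.log_le_log (by positivity) (by norm_num : (25 : ℝ) ^ 44 ≤ 27 ^ 43)
      rw [Real.log_pow, Real.log_pow] at this
      exact_mod_cast this
    have h4 : 3 * Real.log 3 = Real.log 27 := by
      rw [show (27 : ℝ) = 3 ^ 3 by norm_num, Real.log_pow]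
      norm_num
    have h5 : k * (44 * Real.log 25) ≤ k * (43 * Real.log 27) :=
      mul_le_mul_of_nonneg_left h3 (Nat.cast_nonneg k)
    have h6 : 200 * Real.log 27 ≤ k * Real.log 27 := mul_le_mul_of_nonneg_right hk' h27.le
    linarith
  have hn0 : 0 ≤ Real.log n := (hpos.trans_le hlogn).le
  calc Real.log c * Real.log 21
      ≤ 49 / 50 * (k * Real.log 27) * Real.log 21 :=
        mul_le_mul_of_nonneg_right (hlogc.trans h2) h21.le
    _ ≤ Real.log 20 * (k * Real.log 27) := by nlinarith
    _ ≤ Real.log 20 * Real.log n :=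
        mul_le_mul_of_nonneg_left hlogn (Real.log_nonneg (by norm_num))

end Nest

/-! ### The theorem -/

theorem theorem2 :
    (∃ F : ℕ → FinGraph,
      (∀ i j : ℕ, i ≠ j → IsEmpty ((F i).2 ≃g (F j).2)) ∧
      ∀ i : ℕ, KConnected 5 (F i).2 ∧ WeaklyLocallyMaximalOnePlanar (F i).2 ∧
        ¬ Traceable (F i).2) ∧
    shortnessExponent {G : FinGraph | KConnected 5 G.2 ∧ OnePlanar G.2} ≤
      ((Real.log 20 / Real.log 21 : ℝ) : EReal) := by
  constructor
  -- Only the innermost site 26 is replaced. The height starts at 1, since the tower of height 0 is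
  -- a single vertex; the orders increase strictly, so no two members are isomorphic.
  · refine ⟨fun i => (Nest.tower (fun t => t == 26) (i + 1)).toFin, fun i j hij => ⟨fun ψ => ?_⟩,
      fun i => ⟨Nest.kConnected_tower i, ?_, Nest.not_traceable_tower i⟩⟩
    · have h := Fintype.card_congr ψ.toEquiv
      rw [Fintype.card_fin, Fintype.card_fin] at h
      have := (Nest.card_tower_strictMono (P := fun t => t == 26) (t := 26) rfl).injective h
      omega
    · refine (Nest.fits_tower _).straight.weaklyLocallyMaximal_toFin
        (Nest.locallyMaximal_tower (fun t i q h => ?_) _)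
      exact beq_eq_false_iff_ne.2 (Nest.innermost_check t i fun heq => h.2 (heq.symm.trans h.1))
  -- It suffices to meet the bound for members of arbitrarily large order, here the towers with all
  -- 27 sites replaced.
  · refine liminf_le_of_frequently_le' ?_
    rw [frequently_iff]
    intro U hU
    rw [mem_inf_principal, mem_comap] at hU
    obtain ⟨A, hA, hAU⟩ := hU
    obtain ⟨N, hN⟩ := mem_atTop_sets.1 hA
    obtain ⟨k, hk, hNk⟩ : ∃ k, 200 ≤ k + 1 ∧ N ≤ k := ⟨N + 200, by omega, by omega⟩
    have hcard := Nest.pow_le_card_tower (k + 1)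
    refine ⟨(Nest.tower (fun _ => true) (k + 1)).toFin, hAU (hN _ ?_)
      ⟨Nest.kConnected_tower _, (Nest.fits_tower _).straight.onePlanar_toFin⟩, ?_⟩
    · have h1 : k + 1 < 27 ^ (k + 1) := Nat.lt_pow_self (by norm_num)
      change N ≤ Fintype.card _
      omega
    · exact EReal.coe_le_coe_iff.2
        (Nest.log_le_of_large hk hcard (Nest.circ_tower_le _))
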